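/- **Notation.** Let $S$ be a left cancellative monoid with identity $e$ and group of units $S^*$. On $\ell^2(S)$ let $\lambda_s\delta_t=\delta_{st}$, and let $C^*_r(S)$ be the C$^*$-algebra generated by the operators $\lambda_s$, $s\in S$. Let $I_\ell(S)$ be the left inverse hull of $S$, that is, the inverse semigroup of partial bijections of $S$ generated by the left translations $t\mapsto st$. Let $\mathcal J(S)$ be the set of constructible right ideals, i.e. of the sets $X\subset S$ such that the identity map $p_X$ on $X$ belongs to $I_\ell(S)$; thus $E(S)=\{p_X\mid X\in\mathcal J(S)\}$ is the semilattice of idempotents of $I_\ell(S)$. A semi-character of $E(S)$ is a nonzero multiplicative map $\chi\colon E(S)\to\{0,1\}$; semi-characters carry the topology of pointwise convergence. For $s\in S$ put $\chi_s(p_X)=\mathbf 1_X(s)$, and let $\Omega(S)=\overline{\{\chi_s\mid s\in S\}}$. *The groupoids.* The étale groupoid $\mathcal G_P(S)$ consists of the classes $[g,\chi]$ of pairs $g\in I_\ell(S)$, $\chi\in\Omega(S)$ with $\chi(g^{-1}g)=1$, where $[g,\chi]=[h,\psi]$ if and only if $\chi=\psi$ and $gp=hp$ for some $p\in E(S)$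 with $\chi(p)=1$. The groupoid $\mathcal G(S)$ consists of the classes of the same pairs for the coarser relation: $[g,\chi]=[h,\psi]$ if and only if $\chi=\psi$ and there are $X,X_1,\dots,X_m\in\mathcal J(S)$, $m\ge0$, such that $\chi(p_X)=1$, $\chi(p_{X_i})=0$ for all $i$, and $g$ and $h$ are defined and equal on $X\setminus\bigcup_{i=1}^mX_i$. In both cases the source and range of $[g,\chi]$ are $\chi$ and $\chi(g^{-1}\cdot g)$, the product is $[g,\chi][h,\psi]=[gh,\psi]$ if $\chi=\psi(h^{-1}\cdot h)$, the inverse of $[g,\chi]$ is $[g^{-1},\chi(g^{-1}\cdot g)]$, the unit space is $\Omega(S)$, where $\chi$ is identified with $[p_S,\chi]$, and the sets $D(g,U)=\{[g,\chi]\mid\chi\in U\}$, with $U$ an open subset of $\{\chi\in\Omega(S)\mid\chi(g^{-1}g)=1\}$, form a basis of the topology. *The groupoid C$^*$-algebras.* For an étale groupoid $\mathcal G$ with locally compact Hausdorff unit space, let $C_c(\mathcal G)$ be the span of the functions on $\mathcal G$ that vanish outside an open bisection $U$ and whose restriction to $U$ is continuous and compactly supported. For $x\in\mathcal G^{(0)}$,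 let $\rho_x$ be the representation of $C_c(\mathcal G)$ on $\ell^2(\mathcal G_x)$, $\mathcal G_x=s^{-1}(x)$, given by $(\rho_x(f)\xi)(g)=\sum_{h\in\mathcal G^{r(g)}}f(h)\xi(h^{-1}g)$, where $\mathcal G^{y}=r^{-1}(y)$. Then $C^*_r(\mathcal G)$ is the completion of $C_c(\mathcal G)$ in the norm $\|f\|_r=\sup_x\|\rho_x(f)\|$, and $\rho_x$ extends to $C^*_r(\mathcal G)$. The set $J_{\mathrm{sing}}$ of all $a\in C^*_r(\mathcal G)$ such that $\{x\in\mathcal G^{(0)}\mid\rho_x(a)\delta_x\ne0\}$ is meager is a closed two-sided ideal, and $C^*_{\mathrm{ess}}(\mathcal G)=C^*_r(\mathcal G)/J_{\mathrm{sing}}$. For $\mathcal G=\mathcal G_P(S)$ or $\mathcal G=\mathcal G(S)$, the map $S\to\mathcal G_{\chi_e}$, $s\mapsto[s,\chi_e]$, where $s\in S$ is identified with the left translation by $s$, is a bijection, and we use it to view $\rho_{\chi_e}$ as a representation on $\ell^2(S)$. **Proposition 2.13.** Let $S$ be a countable left cancellative monoid. Assume that for every unit $u\in S^*$, $u\ne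 e$, there are $X_1,\dots,X_m\in\mathcal J(S)$, $m\ge0$, such that $\bigcup_{i=1}^mX_i\ne S$ and $us\ne s$ for all $s\notin\bigcup_{i=1}^mX_i$. Then $\rho_{\chi_e}$ maps $C^*_r(\mathcal G_P(S))$ and $C^*_r(\mathcal G(S))$ into $C^*_r(S)$, and the maps $\rho_{\chi_e}\colon C^*_r(\mathcal G_P(S))\to C^*_r(S)$ and $\rho_{\chi_e}\colon C^*_r(\mathcal G(S))\to C^*_r(S)$ factor through $*$-isomorphisms $$ C^*_{\mathrm{ess}}(\mathcal G_P(S))\cong C^*_r(S)\cong C^*_{\mathrm{ess}}(\mathcal G(S)). $$ -/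

import Mathlib

open Set Topology
open scoped ENNReal

/-! ### Étale groupoids -/

/-- A locally compact étale groupoid with space of arrows `G` and unit space `X` (embedded in `G`
by `one`).  `mul g h _` is the product `g h`, defined when the source of `g` is the range of `h`.
`G` is not assumed Hausdorff; `X` is locally compact Hausdorff, and so `G` is locally compact. -/
structure EtaleGroupoid (G X : Type*) [TopologicalSpace G] [TopologicalSpace X] where
  src : G → X
  rng : G → X
  one : X → G
  inv : G → G
  mul : (g h : G) → src g = rng h → G
  src_one : ∀ x, src (one x) = x
  rng_one : ∀ x, rng (one x) = x
  src_inv : ∀ g, src (inv g) = rng g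
  rng_inv : ∀ g, rng (inv g) = src g
  src_mul : ∀ g h H, src (mul g h H) = src h
  rng_mul : ∀ g h H, rng (mul g h H) = rng g
  mul_assoc : ∀ g h k (H : src g = rng h) (K : src h = rng k),
    mul (mul g h H) k ((src_mul g h H).trans K) = mul g (mul h k K) (H.trans (rng_mul h k K).symm)
  one_mul : ∀ g, mul (one (rng g)) g (src_one _) = g
  mul_one : ∀ g, mul g (one (src g)) (rng_one _).symm = g
  inv_mul : ∀ g, mul (inv g) g (src_inv g) = one (src g)
  mul_inv : ∀ g, mul g (inv g) (rng_inv g).symm = one (rng g)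
  t2Space : T2Space X
  locallyCompactSpace : LocallyCompactSpace X
  isLocalHomeomorph_src : IsLocalHomeomorph src
  isLocalHomeomorph_rng : IsLocalHomeomorph rng
  continuous_one : Continuous one
  continuous_inv : Continuous inv
  continuous_mul :
    Continuous fun p : {p : G × G // src p.1 = rng p.2} => mul p.1.1 p.1.2 p.2

/-! ### Left inverse hull, constructible ideals, semi-characters -/

namespace LCMonoid

/-- The idempotent `p_X`: the identity map with domain `X`. -/
noncomputable def idOn {S : Type*} (X : Set S) : S ≃. S := open Classical in PEquiv.ofSet X

theorem idOn_eq_some {S : Type*} (X : Set S) (a b : S) : idOn X a = some b ↔ a = b ∧ a ∈ X := by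
  unfold idOn; exact PEquiv.ofSet_eq_some_iff.trans (by aesop)

variable {S : Type*} [LeftCancelMonoid S]

/-- The left translation `t ↦ s t`, as a partial bijection of `S` with domain `S` and
range `s S`. -/
noncomputable def leftMul (s : S) : S ≃. S where
  toFun t := some (s * t)
  invFun r := open Classical in if h : ∃ t, s * t = r then some h.choose else none
  inv a b := by
    classical
    by_cases h : ∃ t, s * t = b
    · have := h.choose_spec
      simp only [h, ↓reduceDIte, Option.some.injEq]
      constructor
      · rintro rfl; exact this
      · intro h2; exact mul_left_cancel (this.trans h2.symm)
    · simp only [h, ↓reduceDIte, Option.some.injEq, reduceCtorEq, false_iff]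
      exact fun h2 => h ⟨a, h2⟩

/-- The left inverse hull `I_ℓ(S)` of `S`, as a set of partial bijections: the smallest set
containing the left translations and closed under composition and inversion
(`h.trans g` is `g ∘ h`). -/
inductive InHull : (S ≃. S) → Prop
  | leftMul (s : S) : InHull (leftMul s)
  | comp (g h : S ≃. S) : InHull g → InHull h → InHull (h.trans g)
  | symm (g : S ≃. S) : InHull g → InHull g.symm

variable (S) in
/-- The left inverse hull `I_ℓ(S)`. -/
def Hull : Type _ := {g : S ≃. S // InHull g}

namespace Hull

/-- The element of `I_ℓ(S)` given by the left translation by `s`. -/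
noncomputable def of (s : S) : Hull S := ⟨leftMul s, .leftMul s⟩

/-- The product `g h` is the composition `g ∘ h` of partial maps. -/
instance : Mul (Hull S) := ⟨fun g h => ⟨h.1.trans g.1, .comp _ _ g.2 h.2⟩⟩

instance : Inv (Hull S) := ⟨fun g => ⟨g.1.symm, .symm _ g.2⟩⟩

theorem leftMul_one : leftMul (1 : S) = PEquiv.refl S := by
  ext a b; simp [leftMul, PEquiv.refl]

noncomputable instance : One (Hull S) := ⟨of 1⟩

theorem one_val : (1 : Hull S).1 = PEquiv.refl S := leftMul_one

@[ext] theorem ext' {g h : Hull S} (H : ∀ t, g.1 t = h.1 t) : g = h := Subtype.ext (PEquiv.ext H)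

theorem mul_assoc' (g h k : Hull S) : g * h * k = g * (h * k) :=
  Subtype.ext (PEquiv.trans_assoc k.1 h.1 g.1).symm

theorem mul_apply (g h : Hull S) (t : S) : (g * h).1 t = (h.1 t).bind g.1 := rfl

theorem inv_eq_some (g : Hull S) {t r : S} : g⁻¹.1 r = some t ↔ g.1 t = some r :=
  PEquiv.eq_some_iff g.1

end Hull

variable (S) in
/-- The semilattice `𝒥(S)` of constructible right ideals of `S`: the sets `X ⊆ S` such that the
identity map `p_X` of `X` belongs to `I_ℓ(S)`.  Thus `X ↦ p_X` identifies `𝒥(S)`, with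
intersection, with the semigroup `E(S)` of idempotents of `I_ℓ(S)`. -/
def CIdeal : Type _ := {X : Set S // InHull (idOn X)}

namespace CIdeal

instance : SetLike (CIdeal S) S := ⟨Subtype.val, Subtype.val_injective⟩

/-- The intersection `X ∩ Y`, corresponding to the product `p_X p_Y`. -/
instance : Min (CIdeal S) := ⟨fun X Y => ⟨X.1 ∩ Y.1, by
  have : idOn (X.1 ∩ Y.1) = (idOn Y.1).trans (idOn X.1) := by
    ext a b
    simp only [PEquiv.trans_eq_some, idOn_eq_some, mem_inter_iff]
    aesop
  rw [this]; exact .comp _ _ X.2 Y.2⟩⟩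

theorem mem_inf (X Y : CIdeal S) (t : S) : t ∈ X ⊓ Y ↔ t ∈ X ∧ t ∈ Y := Iff.rfl

end CIdeal

namespace Hull

/-- The preimage `g⁻¹(X)` of a set under a partial bijection. -/
def preimage (g : Hull S) (A : Set S) : Set S := {t | ∃ r ∈ A, g.1 t = some r}

/-- The preimage `g⁻¹(X)` of a constructible ideal, with idempotent `g⁻¹ p_X g`. -/
def preim (g : Hull S) (X : CIdeal S) : CIdeal S := ⟨g.preimage X, by
  have : idOn (g.preimage X) = (g.1.trans (idOn X.1)).trans g.1.symm := by
    ext a b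
    simp only [PEquiv.trans_eq_some, idOn_eq_some, PEquiv.eq_some_iff, preimage,
      mem_ofPred_eq]
    constructor
    · rintro ⟨rfl, r, hr, h⟩; exact ⟨r, ⟨r, h, rfl, hr⟩, h⟩
    · rintro ⟨r, ⟨r', h, rfl, hr⟩, h2⟩; exact ⟨g.1.inj h h2, _, hr, h⟩
  rw [this]; exact .comp _ _ (.symm _ g.2) (.comp _ _ X.2 g.2)⟩

theorem mem_preim (g : Hull S) (X : CIdeal S) (t : S) :
    t ∈ g.preim X ↔ ∃ r ∈ X, g.1 t = some r := Iff.rfl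

/-- The domain of definition of `g`, a constructible ideal with idempotent `g⁻¹ g`. -/
def dom (g : Hull S) : CIdeal S := ⟨{t | ∃ r, g.1 t = some r}, by
  have : idOn {t | ∃ r, g.1 t = some r} = g.1.trans g.1.symm := by
    ext a b
    simp only [PEquiv.trans_eq_some, idOn_eq_some, PEquiv.eq_some_iff,
      mem_ofPred_eq]
    constructor
    · rintro ⟨rfl, r, h⟩; exact ⟨r, h, h⟩
    · rintro ⟨r, h, h2⟩; exact ⟨g.1.inj h h2, _, h⟩
  rw [this]; exact .comp _ _ (.symm _ g.2) g.2⟩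

theorem mem_dom (g : Hull S) (t : S) : t ∈ g.dom ↔ ∃ r, g.1 t = some r := Iff.rfl

end Hull

variable (S) in
/-- The space of semi-characters of `E(S) ≅ 𝒥(S)`: semigroup homomorphisms to `({0, 1}, ·)` that
are not identically zero, with the topology of pointwise convergence. -/
def SemiChar : Type _ :=
  {χ : CIdeal S → Bool // (∀ X Y, χ (X ⊓ Y) = (χ X && χ Y)) ∧ ∃ X, χ X = true}

instance : TopologicalSpace (SemiChar S) := instTopologicalSpaceSubtype

/-- The semi-character `χ_s`, with `χ_s(p_X) = 1` if and only if `s ∈ X`. -/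
noncomputable def pointChar (s : S) : SemiChar S :=
  ⟨fun X => open Classical in decide (s ∈ X), by
    refine ⟨fun X Y => ?_, (1 : Hull S).dom, ?_⟩
    · rw [Bool.eq_iff_iff, Bool.and_eq_true]
      simp only [decide_eq_true_eq, CIdeal.mem_inf]
    · simp [Hull.mem_dom, Hull.one_val]⟩

variable (S) in
/-- The closure `Ω(S)` of the set of the semi-characters `χ_s`, `s ∈ S` (which is the orbit of
`χ_e`). -/
def Omega : Type _ := {χ : SemiChar S // χ ∈ closure (range (pointChar (S := S)))}

instance : TopologicalSpace (Omega S) := instTopologicalSpaceSubtype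

namespace Omega

instance : CoeFun (Omega S) fun _ => CIdeal S → Bool := ⟨fun χ => χ.1.1⟩

@[ext] theorem ext' {χ ψ : Omega S} (h : ∀ X, χ X = ψ X) : χ = ψ :=
  Subtype.ext (Subtype.ext (funext h))

/-- The point `χ_s` of `Ω(S)`. -/
noncomputable def pt (s : S) : Omega S := ⟨pointChar s, subset_closure ⟨s, rfl⟩⟩

theorem pt_apply (s : S) (X : CIdeal S) : pt s X = true ↔ s ∈ X := by
  simp [pt, pointChar]

theorem continuous_apply (X : CIdeal S) : Continuous fun χ : Omega S => χ X :=
  (_root_.continuous_apply X).comp (continuous_subtype_val.comp continuous_subtype_val)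

theorem isClopen_setOf (X : CIdeal S) : IsClopen {χ : Omega S | χ X = true} :=
  (isClopen_discrete {true}).preimage (continuous_apply X)

theorem exists_pt_of_mem_closure {χ : SemiChar S} (h : χ ∈ closure (range (pointChar (S := S))))
    (F : Finset (CIdeal S)) : ∃ s : S, ∀ X ∈ F, χ.1 X = true ↔ s ∈ X := by
  have hU : IsOpen {ψ : SemiChar S | ∀ X ∈ F, ψ.1 X = χ.1 X} := by
    have : {ψ : SemiChar S | ∀ X ∈ F, ψ.1 X = χ.1 X} = ⋂ X ∈ F, {ψ | ψ.1 X = χ.1 X} := by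
      ext; simp
    rw [this]
    refine isOpen_biInter_finset fun X _ => ?_
    have hc : Continuous fun ψ : SemiChar S => ψ.1 X :=
      (_root_.continuous_apply X).comp continuous_subtype_val
    exact (isOpen_discrete {χ.1 X}).preimage hc
  obtain ⟨_, h1, s, rfl⟩ := mem_closure_iff.1 h _ hU fun _ _ => rfl
  refine ⟨s, fun X hX => ?_⟩
  rw [← h1 X hX]; simp [pointChar]

theorem exists_pt (χ : Omega S) (F : Finset (CIdeal S)) :
    ∃ s : S, ∀ X ∈ F, χ X = true ↔ s ∈ X := exists_pt_of_mem_closure χ.2 F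

theorem mem_closure_of {χ : SemiChar S}
    (h : ∀ F : Finset (CIdeal S), ∃ s : S, ∀ X ∈ F, χ.1 X = true ↔ s ∈ X) :
    χ ∈ closure (range (pointChar (S := S))) := by
  have hi : IsInducing (fun χ : SemiChar S => χ.1) := ⟨rfl⟩
  rw [hi.closure_eq_preimage_closure_image, mem_preimage, mem_closure_iff]
  intro U hU hχ
  obtain ⟨F, u, hu, hsub⟩ := isOpen_pi_iff.1 hU _ hχ
  obtain ⟨s, hs⟩ := h F
  refine ⟨(pointChar s).1, hsub fun X hX => ?_, _, ⟨s, rfl⟩, rfl⟩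
  have : (pointChar s).1 X = χ.1 X := by
    rw [Bool.eq_iff_iff, hs X hX]; simp [pointChar]
  rw [this]; exact (hu X hX).2

theorem map_inf (χ : Omega S) (X Y : CIdeal S) : χ (X ⊓ Y) = true ↔ χ X = true ∧ χ Y = true := by
  rw [χ.1.2.1, Bool.and_eq_true]

theorem map_mono (χ : Omega S) {X Y : CIdeal S} (h : ∀ t ∈ X, t ∈ Y) (hX : χ X = true) :
    χ Y = true := by
  have : X ⊓ Y = X := SetLike.ext fun t =>
    (CIdeal.mem_inf X Y t).trans ⟨fun H => H.1, fun H => ⟨H, h t H⟩⟩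
  rw [← this, map_inf] at hX; exact hX.2

theorem map_dom_one (χ : Omega S) : χ (1 : Hull S).dom = true := by
  obtain ⟨X, hX⟩ := χ.1.2.2
  exact χ.map_mono (fun t _ => by simp [Hull.mem_dom, Hull.one_val]) hX

/-- For `g ∈ I_ℓ(S)` and `χ` with `χ(g⁻¹ g) = 1`, the semi-character `χ(g⁻¹ · g)`. -/
def act (g : Hull S) (χ : Omega S) (h : χ g.dom = true) : Omega S :=
  ⟨⟨fun X => χ (g.preim X), by
    refine ⟨fun X Y => ?_, g⁻¹.dom, ?_⟩
    · rw [← χ.1.2.1]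
      refine congrArg χ.1.1 (SetLike.ext fun t => ?_)
      simp only [CIdeal.mem_inf, Hull.mem_preim]
      constructor
      · rintro ⟨r, hr, h⟩; exact ⟨⟨r, hr.1, h⟩, r, hr.2, h⟩
      · rintro ⟨⟨r, hr, h⟩, r', hr', h'⟩
        rw [h] at h'; cases h'; exact ⟨r, ⟨hr, hr'⟩, h⟩
    · refine χ.map_mono (fun t ht => ?_) h
      obtain ⟨r, hr⟩ := ht
      exact ⟨r, ⟨t, (Hull.inv_eq_some g).2 hr⟩, hr⟩⟩, by
    classical
    refine mem_closure_of fun F => ?_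
    obtain ⟨s, hs⟩ := χ.exists_pt (insert g.dom (F.image g.preim))
    obtain ⟨r, hr⟩ := (hs _ (Finset.mem_insert_self _ _)).1 h
    refine ⟨r, fun X hX => ?_⟩
    refine (hs _ (Finset.mem_insert_of_mem (Finset.mem_image_of_mem _ hX))).trans ?_
    rw [Hull.mem_preim]
    constructor
    · rintro ⟨r', h1, h2⟩; rw [hr] at h2; cases h2; exact h1
    · exact fun h => ⟨r, h, hr⟩⟩

theorem act_apply (g : Hull S) (χ : Omega S) (h) (X : CIdeal S) :
    act g χ h X = χ (g.preim X) := rfl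

theorem dom_inv_act (g : Hull S) (χ : Omega S) (h : χ g.dom = true) :
    act g χ h g⁻¹.dom = true := by
  refine χ.map_mono (fun t ht => ?_) h
  obtain ⟨r, hr⟩ := ht
  exact ⟨r, ⟨t, (Hull.inv_eq_some g).2 hr⟩, hr⟩

theorem act_inv_act (g : Hull S) (χ : Omega S) (h : χ g.dom = true) :
    act g⁻¹ (act g χ h) (dom_inv_act g χ h) = χ := by
  ext X
  rw [act_apply, act_apply, Bool.eq_iff_iff]
  have : g.preim (g⁻¹.preim X) = X ⊓ g.dom := by
    refine SetLike.ext fun t => ?_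
    simp only [CIdeal.mem_inf, Hull.mem_preim, Hull.mem_dom, Hull.inv_eq_some]
    constructor
    · rintro ⟨r, ⟨t', h1, h2⟩, h3⟩
      cases g.1.inj h2 h3; exact ⟨h1, r, h3⟩
    · rintro ⟨h1, r, h2⟩; exact ⟨r, ⟨t, h1, h2⟩, h2⟩
  rw [this, map_inf]; simp [h]

theorem mul_dom (g h : Hull S) : (g * h).dom = h.preim g.dom := by
  refine SetLike.ext fun t => ?_
  simp only [Hull.mem_dom, Hull.mem_preim, Hull.mul_apply, Option.bind_eq_some_iff]
  constructor
  · rintro ⟨r, a, h1, h2⟩; exact ⟨a, ⟨r, h2⟩, h1⟩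
  · rintro ⟨a, ⟨r, h2⟩, h1⟩; exact ⟨r, a, h1, h2⟩

theorem act_mul (g h : Hull S) (χ : Omega S) (hh : χ h.dom = true)
    (hg : act h χ hh g.dom = true) :
    act (g * h) χ (by rw [mul_dom]; exact hg) = act g (act h χ hh) hg := by
  ext X
  rw [act_apply, act_apply, act_apply]
  refine congrArg χ.1.1 (SetLike.ext fun t => ?_)
  simp only [Hull.mem_preim, Hull.mul_apply, Option.bind_eq_some_iff]
  constructor
  · rintro ⟨r, h0, a, h1, h2⟩; exact ⟨a, ⟨r, h0, h2⟩, h1⟩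
  · rintro ⟨a, ⟨r, h0, h2⟩, h1⟩; exact ⟨r, h0, a, h1, h2⟩

theorem act_one (χ : Omega S) : act 1 χ χ.map_dom_one = χ := by
  ext X
  rw [act_apply]
  refine congrArg χ.1.1 (SetLike.ext fun t => ?_)
  simp [Hull.mem_preim, Hull.one_val]

instance : T2Space (Omega S) :=
  inferInstanceAs (T2Space {_χ : {_χ : CIdeal S → Bool // _} // _})

instance : CompactSpace (Omega S) := by
  have h1 : IsClosed {χ : CIdeal S → Bool |
      (∀ X Y, χ (X ⊓ Y) = (χ X && χ Y)) ∧ ∃ X, χ X = true} := by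
    have : {χ : CIdeal S → Bool | (∀ X Y, χ (X ⊓ Y) = (χ X && χ Y)) ∧ ∃ X, χ X = true} =
        (⋂ X, ⋂ Y, {χ | χ (X ⊓ Y) = (χ X && χ Y)}) ∩ {χ | χ (1 : Hull S).dom = true} := by
      ext χ
      simp only [mem_ofPred_eq, mem_inter_iff, mem_iInter]
      refine and_congr_right fun h => ⟨fun ⟨X, hX⟩ => ?_, fun h => ⟨_, h⟩⟩
      have : X ⊓ (1 : Hull S).dom = X :=
        SetLike.ext fun t => (CIdeal.mem_inf _ _ t).trans
          ⟨fun H => H.1, fun H => ⟨H, by simp [Hull.mem_dom, Hull.one_val]⟩⟩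
      rw [← this, h, Bool.and_eq_true] at hX; exact hX.2
    rw [this]
    refine IsClosed.inter (isClosed_iInter fun X => isClosed_iInter fun Y => ?_) ?_
    · refine isClosed_eq (_root_.continuous_apply _) ?_
      have hc : Continuous fun p : Bool × Bool => p.1 && p.2 := continuous_of_discreteTopology
      have hp : Continuous fun χ : CIdeal S → Bool => (χ X, χ Y) :=
        (_root_.continuous_apply X).prodMk (_root_.continuous_apply Y)
      exact hc.comp hp
    · exact isClosed_eq (_root_.continuous_apply _) continuous_const
  have : CompactSpace (SemiChar S) := isCompact_iff_compactSpace.1 h1.isCompact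
  exact isCompact_iff_compactSpace.1 (isClosed_closure.isCompact)

end Omega
/-! ### Groupoids of germs over `Ω(S)` -/

/-- An auxiliary notion used to treat the two groupoids at once: for every `χ ∈ Ω(S)` a family of
subsets of `S` ("neighbourhoods of `χ`") on which two elements of `I_ℓ(S)` have to agree in order
to define the same germ at `χ`. -/
structure GermSystem (S : Type*) [LeftCancelMonoid S] where
  nhd : Omega S → Set (Set S)
  of_mem : ∀ (χ : Omega S) (X : CIdeal S), χ X = true → {t | t ∈ X} ∈ nhd χ
  inter : ∀ χ A B, A ∈ nhd χ → B ∈ nhd χ → A ∩ B ∈ nhd χ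
  preimage : ∀ (g : Hull S) χ h A, A ∈ nhd (Omega.act g χ h) → g.preimage A ∈ nhd χ
  isOpen : ∀ A, IsOpen {χ | A ∈ nhd χ}
  separates : ∀ (χ : Omega S) A (X Y : CIdeal S), A ∈ nhd χ →
    (∀ t ∈ A, t ∈ X ↔ t ∈ Y) → (χ X = true ↔ χ Y = true)
  mem_of_pt : ∀ s A, A ∈ nhd (Omega.pt s) → s ∈ A

variable (S) in
/-- The constructible ideals `X` with `χ(p_X) = 1`. -/
def idealSystem : GermSystem S where
  nhd χ := {A | ∃ X : CIdeal S, A = {t | t ∈ X} ∧ χ X = true}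
  of_mem _ X h := ⟨X, rfl, h⟩
  inter := by
    rintro χ _ _ ⟨X, rfl, hX⟩ ⟨Y, rfl, hY⟩
    exact ⟨X ⊓ Y, rfl, (χ.map_inf X Y).2 ⟨hX, hY⟩⟩
  preimage := by
    rintro g χ h _ ⟨X, rfl, hX⟩
    exact ⟨g.preim X, rfl, hX⟩
  isOpen A := by
    have : {χ : Omega S | A ∈ {A | ∃ X : CIdeal S, A = {t | t ∈ X} ∧ χ X = true}} =
        ⋃ X : CIdeal S, {χ | A = {t | t ∈ X} ∧ χ X = true} := by ext; simp
    rw [this]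
    refine isOpen_iUnion fun X => ?_
    by_cases hA : A = {t | t ∈ X}
    · simpa [hA] using (Omega.isClopen_setOf X).isOpen
    · simp only [hA, false_and]; exact isOpen_const
  separates := by
    classical
    rintro χ _ X Y ⟨Z, rfl, hZ⟩ h
    obtain ⟨s, hs⟩ := χ.exists_pt {X, Y, Z}
    rw [hs X (by simp), hs Y (by simp)]
    exact h s ((hs Z (by simp)).1 hZ)
  mem_of_pt := by
    rintro s _ ⟨X, rfl, hX⟩
    exact (Omega.pt_apply s X).1 hX

/-- The set `X \ (X₁ ∪ … ∪ Xₘ)`. -/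
def diffSet (X : CIdeal S) (F : Finset (CIdeal S)) : Set S := {t | t ∈ X ∧ ∀ Y ∈ F, t ∉ Y}

/-- The extension of `χ ∈ Ω(S)` to the semilattice `𝒥̄(S)` of all sets `X \ (X₁ ∪ … ∪ Xₘ)` with
`X, X₁, …, Xₘ` constructible and `m ≥ 0`: the extension takes the value `1` at `A` if and only if
`A = X \ (X₁ ∪ … ∪ Xₘ)` with `χ(p_X) = 1` and `χ(p_{X_i}) = 0` for all `i`. -/
def Omega.extEqOne (χ : Omega S) (A : Set S) : Prop :=
  ∃ (X : CIdeal S) (F : Finset (CIdeal S)), A = diffSet X F ∧ χ X = true ∧ ∀ Y ∈ F, χ Y = false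

variable (S) in
/-- The sets `A ∈ 𝒥̄(S)` with `χ(p_A) = 1`. -/
def diffSystem : GermSystem S where
  nhd χ := {A | χ.extEqOne A}
  of_mem _ X h := ⟨X, ∅, by simp [diffSet], h, by simp⟩
  inter := by
    classical
    rintro χ _ _ ⟨X, F, rfl, hX, hF⟩ ⟨Y, G, rfl, hY, hG⟩
    refine ⟨X ⊓ Y, F ∪ G, ?_, (χ.map_inf X Y).2 ⟨hX, hY⟩, ?_⟩
    · ext t
      simp only [diffSet, mem_inter_iff, mem_ofPred_eq, CIdeal.mem_inf, Finset.mem_union]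
      grind
    · intro Z hZ
      exact (Finset.mem_union.1 hZ).elim (hF Z) (hG Z)
  preimage := by
    classical
    rintro g χ h _ ⟨X, F, rfl, hX, hF⟩
    refine ⟨g.preim X, F.image g.preim, ?_, hX, ?_⟩
    · ext t
      simp only [diffSet, Hull.preimage, mem_ofPred_eq, Hull.mem_preim, Finset.mem_image,
        forall_exists_index, and_imp, forall_apply_eq_imp_iff₂]
      constructor
      · rintro ⟨r, ⟨h1, h2⟩, h3⟩
        refine ⟨⟨r, h1, h3⟩, ?_⟩
        rintro Y hY ⟨r', h4, h5⟩
        rw [h3] at h5; cases h5; exact h2 Y hY h4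
      · rintro ⟨⟨r, h1, h3⟩, h2⟩
        exact ⟨r, ⟨h1, fun Y hY hr => h2 Y hY ⟨r, hr, h3⟩⟩, h3⟩
    · intro Z hZ
      obtain ⟨Y, hY, rfl⟩ := Finset.mem_image.1 hZ
      exact hF Y hY
  isOpen A := by
    have : {χ : Omega S | A ∈ {A | χ.extEqOne A}} = ⋃ (X : CIdeal S) (F : Finset (CIdeal S)),
        {χ | A = diffSet X F} ∩ ({χ | χ X = true} ∩ ⋂ Y ∈ F, {χ | χ Y = true}ᶜ) := by
      ext χ
      simp [Omega.extEqOne]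
    rw [this]
    refine isOpen_iUnion fun X => isOpen_iUnion fun F => ?_
    refine isOpen_const.inter ((Omega.isClopen_setOf X).isOpen.inter ?_)
    exact isOpen_biInter_finset fun Y _ => (Omega.isClopen_setOf Y).compl.isOpen
  separates := by
    classical
    rintro χ _ X Y ⟨Z, F, rfl, hZ, hF⟩ h
    obtain ⟨s, hs⟩ := χ.exists_pt (insert X (insert Y (insert Z F)))
    rw [hs X (by simp), hs Y (by simp)]
    refine h s ⟨(hs Z (by simp)).1 hZ, fun W hW hsW => ?_⟩
    have := (hs W (by simp [hW])).2 hsW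
    rw [hF W hW] at this; cases this
  mem_of_pt := by
    rintro s _ ⟨X, F, rfl, hX, hF⟩
    refine ⟨(Omega.pt_apply s X).1 hX, fun Y hY hs => ?_⟩
    have := (Omega.pt_apply s Y).2 hs
    rw [hF Y hY] at this; cases this

variable (S) in
/-- The set `Σ` of pairs `(g, χ)`, `g ∈ I_ℓ(S)`, `χ ∈ Ω(S)`, with `χ(g⁻¹ g) = 1`. -/
def PreGerm : Type _ := {p : Hull S × Omega S // p.2 p.1.dom = true}

namespace GermSystem

variable (N : GermSystem S)

/-- `(g, χ)` and `(h, ψ)` are equivalent if `χ = ψ` and `g|_A = h|_A` for some neighbourhood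
`A` of `χ`. -/
def rel (p q : PreGerm S) : Prop :=
  p.1.2 = q.1.2 ∧ ∃ A ∈ N.nhd p.1.2, ∀ t ∈ A, p.1.1.1 t = q.1.1.1 t

/-- The equivalence relation defining germs. -/
def setoid : Setoid (PreGerm S) where
  r := N.rel
  iseqv :=
    { refl := fun p => ⟨rfl, _, N.of_mem _ _ p.2, fun _ _ => rfl⟩
      symm := by
        rintro p q ⟨h, A, hA, H⟩
        exact ⟨h.symm, A, h ▸ hA, fun t ht => (H t ht).symm⟩
      trans := by
        rintro p q r ⟨h, A, hA, H⟩ ⟨h', B, hB, H'⟩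
        refine ⟨h.trans h', A ∩ B, N.inter _ _ _ hA (h ▸ hB), fun t ht => ?_⟩
        exact (H t ht.1).trans (H' t ht.2) }

/-- The set of germs `[g, χ]`. -/
def Germ : Type _ := Quotient N.setoid

variable {N}

/-- The germ `[g, χ]`. -/
def germ (g : Hull S) (χ : Omega S) (h : χ g.dom = true) : N.Germ :=
  Quotient.mk N.setoid ⟨(g, χ), h⟩

theorem germ_eq_germ {g h : Hull S} {χ : Omega S} (hg : χ g.dom = true) (hh : χ h.dom = true) :
    (germ g χ hg : N.Germ) = germ h χ hh ↔ ∃ A ∈ N.nhd χ, ∀ t ∈ A, g.1 t = h.1 t := by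
  exact (Quotient.eq (r := N.setoid)).trans ⟨fun h => h.2, fun h => ⟨rfl, h⟩⟩

theorem germ_congr {g h : Hull S} {χ ψ : Omega S} (hg : χ g.dom = true) (e : g = h) (e' : χ = ψ) :
    (germ g χ hg : N.Germ) = germ h ψ (e ▸ e' ▸ hg) := by subst e e'; rfl

/-- The source `χ` of `[g, χ]`. -/
def src : N.Germ → Omega S := Quotient.lift (fun p => p.1.2) fun _ _ h => h.1

theorem act_eq {g h : Hull S} {χ : Omega S} (hg : χ g.dom = true) (hh : χ h.dom = true)
    {A : Set S} (hA : A ∈ N.nhd χ) (H : ∀ t ∈ A, g.1 t = h.1 t) :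
    Omega.act g χ hg = Omega.act h χ hh := by
  ext X
  rw [Bool.eq_iff_iff]
  exact N.separates χ A _ _ hA fun t ht => by simp only [Hull.mem_preim, H t ht]

/-- The range `χ(g⁻¹ · g)` of `[g, χ]`. -/
def rng : N.Germ → Omega S := Quotient.lift (fun p => Omega.act p.1.1 p.1.2 p.2) (by
  rintro ⟨⟨g, χ⟩, hg⟩ ⟨⟨h, ψ⟩, hh⟩ ⟨e, A, hA, H⟩
  dsimp only at e
  subst e
  exact act_eq hg hh hA H)

@[simp] theorem src_germ (g : Hull S) (χ h) : src (germ g χ h : N.Germ) = χ := rfl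

@[simp] theorem rng_germ (g : Hull S) (χ h) : rng (germ g χ h : N.Germ) = Omega.act g χ h := rfl

/-- Every germ is of the form `[g, χ]`. -/
theorem exists_germ (a : N.Germ) : ∃ g χ h, a = germ g χ h := by
  induction a using Quotient.ind with | _ p => exact ⟨p.1.1, p.1.2, p.2, rfl⟩

/-- The unit `[p_S, χ]` at `χ`. -/
noncomputable def one (χ : Omega S) : N.Germ := germ 1 χ χ.map_dom_one

/-- The inverse `[g⁻¹, χ(g⁻¹ · g)]` of `[g, χ]`. -/
def inv : N.Germ → N.Germ :=
  Quotient.lift (fun p => germ p.1.1⁻¹ (Omega.act p.1.1 p.1.2 p.2) (Omega.dom_inv_act _ _ _)) (by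
    rintro ⟨⟨g, χ⟩, hg⟩ ⟨⟨h, ψ⟩, hh⟩ ⟨e, A, hA, H⟩
    dsimp only at e hA H ⊢
    subst e
    have hact := act_eq hg hh hA H
    rw [germ_congr (Omega.dom_inv_act h χ hh) rfl hact.symm, germ_eq_germ]
    refine ⟨g⁻¹.preimage A, N.preimage _ _ (Omega.dom_inv_act g χ hg) _ ?_, ?_⟩
    · rw [Omega.act_inv_act]; exact hA
    · rintro r ⟨t, ht, hr⟩
      rw [hr, eq_comm, Hull.inv_eq_some, ← H t ht, ← Hull.inv_eq_some, hr])

theorem inv_germ (g : Hull S) (χ h) :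
    inv (germ g χ h : N.Germ) = germ g⁻¹ (Omega.act g χ h) (Omega.dom_inv_act _ _ _) := rfl

theorem dom_mul {g h : Hull S} {χ : Omega S} (hh : χ h.dom = true)
    (hg : Omega.act h χ hh g.dom = true) : χ (g * h).dom = true := by
  rw [Omega.mul_dom]; exact hg

theorem mul_congr {g g' h h' : Hull S} {χ : Omega S} (hh : χ h.dom = true)
    (hg : Omega.act h χ hh g.dom = true) (hh' : χ h'.dom = true)
    (hg' : Omega.act h' χ hh' g'.dom = true)
    (e : (germ h χ hh : N.Germ) = germ h' χ hh')
    (e' : (germ g _ hg : N.Germ) = germ g' _ hg') :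
    (germ (g * h) χ (dom_mul hh hg) : N.Germ) = germ (g' * h') χ (dom_mul hh' hg') := by
  obtain ⟨A, hA, H⟩ := (germ_eq_germ _ _).1 e
  have hact := act_eq hh hh' hA H
  rw [germ_congr hg' rfl hact.symm, germ_eq_germ] at e'
  obtain ⟨B, hB, H'⟩ := e'
  rw [germ_eq_germ]
  refine ⟨A ∩ h.preimage B, N.inter _ _ _ hA (N.preimage _ _ hh _ hB), ?_⟩
  rintro t ⟨ht, r, hr, htr⟩
  rw [Hull.mul_apply, Hull.mul_apply, ← H t ht, htr]
  exact H' r hr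

/-- The product `[g, χ] [h, ψ] = [g h, ψ]`, defined if `χ = ψ(h⁻¹ · h)`. -/
noncomputable def mul (a b : N.Germ) (H : src a = rng b) : N.Germ :=
  germ ((exists_germ a).choose * (exists_germ b).choose) (src b) (by
    obtain ⟨χ, h, e⟩ := (exists_germ a).choose_spec
    obtain ⟨ψ, k, f⟩ := (exists_germ b).choose_spec
    have hb := congrArg src f
    rw [src_germ] at hb
    subst hb
    refine dom_mul k ?_
    have h1 := congrArg src e
    have h2 := congrArg rng f
    rw [src_germ] at h1
    rw [rng_germ] at h2
    rw [← h2, ← H, h1]; exact h)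

theorem mul_germ (g h : Hull S) (χ : Omega S) (hh : χ h.dom = true)
    (hg : Omega.act h χ hh g.dom = true) (H) :
    mul (germ g _ hg) (germ h χ hh : N.Germ) H = germ (g * h) χ (dom_mul hh hg) := by
  have ea := (exists_germ (germ g _ hg : N.Germ)).choose_spec
  have eb := (exists_germ (germ h χ hh : N.Germ)).choose_spec
  obtain ⟨χ', h1, e1⟩ := ea
  obtain ⟨ψ, h2, e2⟩ := eb
  have f1 : Omega.act h χ hh = χ' := congrArg src e1
  have f2 : χ = ψ := congrArg src e2
  subst f1 f2
  have f3 := congrArg rng e2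
  rw [rng_germ, rng_germ] at f3
  exact (mul_congr hh hg h2 (f3 ▸ h1) e2 (e1.trans (germ_congr h1 rfl f3))).symm

/-! #### Topology -/

/-- The set `D(g, U)` of germs `[g, χ]` with `χ ∈ U`. -/
def basicSet (N : GermSystem S) (g : Hull S) (U : Set (Omega S)) : Set N.Germ :=
  {a | ∃ χ ∈ U, ∃ h, a = germ g χ h}

/-- The topology with the sets `D(g, U)`, for `U` open, as a basis
(see `isTopologicalBasis_basicSet`). -/
instance : TopologicalSpace N.Germ :=
  TopologicalSpace.generateFrom {D | ∃ g U, IsOpen U ∧ D = basicSet N g U}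

theorem isOpen_basicSet (g : Hull S) {U : Set (Omega S)} (hU : IsOpen U) :
    IsOpen (basicSet N g U) := TopologicalSpace.isOpen_generateFrom_of_mem ⟨g, U, hU, rfl⟩

/-- The section `χ ↦ [g, χ]`. -/
def sect (N : GermSystem S) (g : Hull S) (χ : {χ : Omega S // χ g.dom = true}) : N.Germ :=
  germ g χ.1 χ.2

theorem continuous_sect (g : Hull S) : Continuous (sect N g) := by
  refine continuous_generateFrom_iff.2 ?_
  rintro _ ⟨h, U, hU, rfl⟩
  have : sect N g ⁻¹' basicSet N h U = Subtype.val ⁻¹' (U ∩ {χ | χ h.dom = true} ∩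
      ⋃ (A : {A : Set S // ∀ t ∈ A, g.1 t = h.1 t}), {χ | A.1 ∈ N.nhd χ}) := by
    ext ⟨χ, hχ⟩
    simp only [mem_preimage, basicSet, mem_ofPred_eq, sect, mem_inter_iff, mem_iUnion,
      Subtype.exists]
    constructor
    · rintro ⟨ψ, hψ, hh, e⟩
      obtain rfl : χ = ψ := congrArg src e
      obtain ⟨A, hA, H⟩ := (germ_eq_germ _ _).1 e
      exact ⟨⟨hψ, hh⟩, A, H, hA⟩
    · rintro ⟨⟨h1, h2⟩, A, H, hA⟩
      exact ⟨χ, h1, h2, (germ_eq_germ _ _).2 ⟨A, hA, H⟩⟩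
  rw [this]
  refine IsOpen.preimage continuous_subtype_val ?_
  exact (hU.inter (Omega.isClopen_setOf _).isOpen).inter (isOpen_iUnion fun A => N.isOpen A.1)

theorem isOpen_iff {V : Set N.Germ} :
    IsOpen V ↔ ∀ g : Hull S, IsOpen {χ : Omega S | ∃ h, germ g χ h ∈ V} := by
  constructor
  · intro hV g
    have : {χ : Omega S | ∃ h, germ g χ h ∈ V} = Subtype.val '' (sect N g ⁻¹' V) := by
      ext χ; simp [sect]
    rw [this]
    exact (Omega.isClopen_setOf g.dom).isOpen.isOpenMap_subtype_val _
      (hV.preimage (continuous_sect g))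
  · intro h
    have : V = ⋃ g : Hull S, basicSet N g {χ : Omega S | ∃ h, germ g χ h ∈ V} := by
      ext a
      obtain ⟨g, χ, hg, rfl⟩ := exists_germ a
      simp only [mem_iUnion, basicSet, mem_ofPred_eq]
      constructor
      · intro ha; exact ⟨g, χ, ⟨hg, ha⟩, hg, rfl⟩
      · rintro ⟨g', ψ, ⟨h1, h2⟩, h3, e⟩; rw [e]; exact h2
    rw [this]
    exact isOpen_iUnion fun g => isOpen_basicSet g (h g)

theorem isTopologicalBasis_basicSet : TopologicalSpace.IsTopologicalBasis
    {D : Set N.Germ | ∃ g U, IsOpen U ∧ D = basicSet N g U} := by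
  refine TopologicalSpace.isTopologicalBasis_of_isOpen_of_nhds ?_ ?_
  · rintro _ ⟨g, U, hU, rfl⟩; exact isOpen_basicSet g hU
  · intro a V ha hV
    obtain ⟨g, χ, hg, rfl⟩ := exists_germ a
    refine ⟨_, ⟨g, _, isOpen_iff.1 hV g, rfl⟩, ⟨χ, ⟨hg, ha⟩, hg, rfl⟩, ?_⟩
    rintro _ ⟨ψ, ⟨h1, h2⟩, h3, rfl⟩
    exact h2

theorem continuous_src : Continuous (src (N := N)) := by
  refine continuous_def.2 fun U hU => isOpen_iff.2 fun g => ?_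
  have : {χ : Omega S | ∃ h, germ g χ h ∈ src (N := N) ⁻¹' U} = U ∩ {χ | χ g.dom = true} := by
    ext χ; simp [and_comm]
  rw [this]
  exact hU.inter (Omega.isClopen_setOf _).isOpen

theorem isOpenMap_src : IsOpenMap (src (N := N)) := by
  intro V hV
  have : src '' V = ⋃ g : Hull S, {χ : Omega S | ∃ h, germ g χ h ∈ V} := by
    ext χ
    simp only [mem_image, mem_iUnion, mem_ofPred_eq]
    constructor
    · rintro ⟨a, ha, rfl⟩
      obtain ⟨g, χ, hg, rfl⟩ := exists_germ a
      exact ⟨g, hg, ha⟩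
    · rintro ⟨g, hg, ha⟩; exact ⟨_, ha, rfl⟩
  rw [this]
  exact isOpen_iUnion fun g => isOpen_iff.1 hV g

theorem isLocalHomeomorph_src : IsLocalHomeomorph (src (N := N)) := by
  rw [isLocalHomeomorph_iff_isOpenEmbedding_restrict]
  intro a
  obtain ⟨g, χ, hg, rfl⟩ := exists_germ a
  have hD : IsOpen (basicSet N g univ) := isOpen_basicSet g isOpen_univ
  refine ⟨basicSet N g univ, hD.mem_nhds ⟨χ, trivial, hg, rfl⟩, ?_⟩
  refine Topology.IsOpenEmbedding.of_continuous_injective_isOpenMap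
    (continuous_src.comp continuous_subtype_val) ?_ (isOpenMap_src.comp hD.isOpenMap_subtype_val)
  rintro ⟨_, ψ, -, h, rfl⟩ ⟨_, ψ', -, h', rfl⟩ (e : ψ = ψ')
  subst e
  rfl

theorem inv_inv (a : N.Germ) : inv (inv a) = a := by
  obtain ⟨g, χ, hg, rfl⟩ := exists_germ a
  rw [inv_germ, inv_germ]
  exact germ_congr _ rfl (Omega.act_inv_act g χ hg)

theorem src_inv (a : N.Germ) : src (inv a) = rng a := by
  obtain ⟨g, χ, hg, rfl⟩ := exists_germ a
  rfl

theorem rng_inv (a : N.Germ) : rng (inv a) = src a := by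
  rw [← src_inv, inv_inv]

theorem continuous_act (g : Hull S) :
    Continuous fun χ : {χ : Omega S // χ g.dom = true} => Omega.act g χ.1 χ.2 := by
  refine Continuous.subtype_mk (Continuous.subtype_mk ?_ _) _
  refine continuous_pi fun X => ?_
  exact (Omega.continuous_apply (g.preim X)).comp continuous_subtype_val

theorem continuous_of_sect {Y : Type*} [TopologicalSpace Y] {f : N.Germ → Y}
    (h : ∀ g, Continuous fun χ => f (sect N g χ)) : Continuous f := by
  refine continuous_def.2 fun U hU => isOpen_iff.2 fun g => ?_
  have : {χ : Omega S | ∃ h, germ g χ h ∈ f ⁻¹' U} =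
      Subtype.val '' ((fun χ => f (sect N g χ)) ⁻¹' U) := by
    ext χ; simp [sect]
  rw [this]
  exact (Omega.isClopen_setOf g.dom).isOpen.isOpenMap_subtype_val _ (hU.preimage (h g))

theorem continuous_inv : Continuous (inv (N := N)) := by
  refine continuous_of_sect fun g => ?_
  exact (continuous_sect g⁻¹).comp
    (Continuous.subtype_mk (continuous_act g) fun χ => Omega.dom_inv_act g χ.1 χ.2)

theorem isLocalHomeomorph_rng : IsLocalHomeomorph (rng (N := N)) := by
  let e : N.Germ ≃ₜ N.Germ :=
    { toFun := inv
      invFun := inv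
      left_inv := inv_inv
      right_inv := inv_inv
      continuous_toFun := continuous_inv
      continuous_invFun := continuous_inv }
  have : rng (N := N) = src ∘ e := funext fun a => (src_inv a).symm
  rw [this]
  exact isLocalHomeomorph_src.comp e.isLocalHomeomorph

theorem continuous_one : Continuous (one (N := N)) :=
  (continuous_sect 1).comp (Continuous.subtype_mk continuous_id fun χ => χ.map_dom_one)

theorem continuous_mul : Continuous
    fun p : {p : N.Germ × N.Germ // src p.1 = rng p.2} => mul p.1.1 p.1.2 p.2 := by
  rw [continuous_iff_continuousAt]
  rintro ⟨⟨a, b⟩, hab⟩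
  obtain ⟨g, χ', hg', rfl⟩ := exists_germ a
  obtain ⟨h, χ, hh, rfl⟩ := exists_germ b
  obtain rfl : χ' = Omega.act h χ hh := hab
  let W : Set {p : N.Germ × N.Germ // src p.1 = rng p.2} :=
    {p | p.1.1 ∈ basicSet N g univ ∧ p.1.2 ∈ basicSet N h univ}
  have hW : IsOpen W :=
    ((isOpen_basicSet g isOpen_univ).preimage (continuous_fst.comp continuous_subtype_val)).inter
      ((isOpen_basicSet h isOpen_univ).preimage (continuous_snd.comp continuous_subtype_val))
  have hmem : ∀ p ∈ W, (src p.1.2) (g * h).dom = true ∧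
      ∀ k, mul p.1.1 p.1.2 p.2 = germ (g * h) (src p.1.2) k := by
    rintro ⟨⟨_, _⟩, H⟩ ⟨⟨ψ', -, k', rfl⟩, ψ, -, k, rfl⟩
    obtain rfl : ψ' = Omega.act h ψ k := H
    exact ⟨dom_mul k k', fun _ => mul_germ _ _ _ _ _ _⟩
  refine ContinuousOn.continuousAt (s := W) ?_
    (hW.mem_nhds ⟨⟨_, trivial, hg', rfl⟩, _, trivial, hh, rfl⟩)
  rw [continuousOn_iff_continuous_domRestrict]
  have : W.domRestrict (fun p => mul p.1.1 p.1.2 p.2) =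
      sect N (g * h) ∘ fun p => ⟨src p.1.1.2, (hmem p.1 p.2).1⟩ :=
    funext fun p => (hmem p.1 p.2).2 _
  rw [this]
  refine (continuous_sect _).comp (Continuous.subtype_mk ?_ _)
  exact continuous_src.comp
    (continuous_snd.comp (continuous_subtype_val.comp continuous_subtype_val))

/-! #### The groupoid -/

theorem one_mul (a : N.Germ) : mul (one (rng a)) a rfl = a := by
  obtain ⟨g, χ, hg, rfl⟩ := exists_germ a
  refine (mul_germ 1 g χ hg (Omega.map_dom_one _) _).trans (germ_congr _ ?_ rfl)
  ext t
  rw [Hull.mul_apply, Hull.one_val]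
  cases g.1 t <;> rfl

theorem rng_one (χ : Omega S) : rng (one χ : N.Germ) = χ := Omega.act_one χ

theorem mul_one (a : N.Germ) : mul a (one (src a)) (rng_one _).symm = a := by
  obtain ⟨g, χ, hg, rfl⟩ := exists_germ a
  have hg' : Omega.act 1 χ χ.map_dom_one g.dom = true := by rw [Omega.act_one]; exact hg
  have e : (germ g χ hg : N.Germ) = germ g _ hg' := germ_congr _ rfl (Omega.act_one χ).symm
  have h1 := mul_germ (N := N) g 1 χ χ.map_dom_one hg' rfl
  have h2 : mul (germ g χ hg) (one χ) (rng_one _).symm =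
      mul (germ g _ hg') (germ 1 χ χ.map_dom_one : N.Germ) rfl := by congr 1
  refine (h2.trans h1).trans (germ_congr _ ?_ rfl)
  ext t
  rw [Hull.mul_apply, Hull.one_val]
  rfl

theorem mul_congr' {a a' b b' : N.Germ} (e : a = a') (e' : b = b') (H : src a = rng b) :
    mul a b H = mul a' b' (by rw [← e, ← e', H]) := by subst e e'; rfl

theorem inv_mul (a : N.Germ) : mul (inv a) a (src_inv a) = one (src a) := by
  obtain ⟨g, χ, hg, rfl⟩ := exists_germ a
  refine (mul_germ g⁻¹ g χ hg (Omega.dom_inv_act g χ hg) rfl).trans ?_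
  refine (germ_eq_germ _ _).2 ⟨_, N.of_mem χ g.dom hg, ?_⟩
  rintro t ⟨r, hr⟩
  rw [Hull.mul_apply, hr, Hull.one_val]
  exact (Hull.inv_eq_some g).2 hr

theorem mul_inv (a : N.Germ) : mul a (inv a) (rng_inv a).symm = one (rng a) := by
  have h := inv_mul (inv a)
  rw [src_inv] at h
  rw [← h]
  exact mul_congr' (inv_inv a).symm rfl _

theorem src_mul (a b : N.Germ) (H : src a = rng b) : src (mul a b H) = src b := rfl

theorem rng_mul (a b : N.Germ) (H : src a = rng b) : rng (mul a b H) = rng a := by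
  obtain ⟨g, χ', hg, rfl⟩ := exists_germ a
  obtain ⟨h, χ, hh, rfl⟩ := exists_germ b
  obtain rfl : χ' = Omega.act h χ hh := H
  exact (congrArg rng (mul_germ g h χ hh hg rfl)).trans (Omega.act_mul g h χ hh hg)

theorem mul_assoc (a b c : N.Germ) (H : src a = rng b) (K : src b = rng c) :
    mul (mul a b H) c K = mul a (mul b c K) (H.trans (rng_mul b c K).symm) := by
  obtain ⟨g, χ₁, hg, rfl⟩ := exists_germ a
  obtain ⟨h, χ₂, hh, rfl⟩ := exists_germ b
  obtain ⟨k, χ, hk, rfl⟩ := exists_germ c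
  obtain rfl : χ₂ = Omega.act k χ hk := K
  obtain rfl : χ₁ = Omega.act h _ hh := H
  have hg' : Omega.act (h * k) χ (dom_mul hk hh) g.dom = true := by
    rw [Omega.act_mul _ _ _ hk hh]; exact hg
  have e1 := mul_germ (N := N) g h _ hh hg rfl
  have e2 := mul_germ (N := N) h k _ hk hh rfl
  have e3 : (germ g _ hg : N.Germ) = germ g _ hg' := germ_congr _ rfl (Omega.act_mul _ _ _ hk hh).symm
  have e4 := mul_germ (N := N) (g * h) k _ hk (dom_mul hh hg) rfl
  have e5 := mul_germ (N := N) g (h * k) _ (dom_mul hk hh) hg' rfl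
  exact ((mul_congr' e1 rfl _).trans e4).trans ((germ_congr _ (Hull.mul_assoc' g h k) rfl).trans
    ((mul_congr' e3 e2 _).trans e5).symm)

end GermSystem

/-- The étale groupoid of germs `[g, χ]`, with unit space `Ω(S)`. -/
noncomputable def GermSystem.groupoid (N : GermSystem S) :
    EtaleGroupoid N.Germ (Omega S) where
  src := GermSystem.src
  rng := GermSystem.rng
  one := GermSystem.one
  inv := GermSystem.inv
  mul := GermSystem.mul
  src_one _ := rfl
  rng_one := GermSystem.rng_one
  src_inv := GermSystem.src_inv
  rng_inv := GermSystem.rng_inv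
  src_mul := GermSystem.src_mul
  rng_mul := GermSystem.rng_mul
  mul_assoc := GermSystem.mul_assoc
  one_mul := GermSystem.one_mul
  mul_one := GermSystem.mul_one
  inv_mul := GermSystem.inv_mul
  mul_inv := GermSystem.mul_inv
  t2Space := inferInstance
  locallyCompactSpace := inferInstance
  isLocalHomeomorph_src := GermSystem.isLocalHomeomorph_src
  isLocalHomeomorph_rng := GermSystem.isLocalHomeomorph_rng
  continuous_one := GermSystem.continuous_one
  continuous_inv := GermSystem.continuous_inv
  continuous_mul := GermSystem.continuous_mul

variable (S) in
/-- The groupoid `𝒢_P(S)`: the reduction to `Ω(S)` of the Paterson groupoid of `I_ℓ(S)`.  Here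
`[g, χ] = [h, χ]` if and only if `g p_X = h p_X` for a constructible ideal `X` with
`χ(p_X) = 1`. -/
noncomputable def groupoidP : EtaleGroupoid (idealSystem S).Germ (Omega S) :=
  (idealSystem S).groupoid

variable (S) in
/-- The groupoid `𝒢(S)`: the quotient of `𝒢_P(S)` in which `[g, χ] = [h, χ]` if and only if
`g|_A = h|_A` for a set `A ∈ 𝒥̄(S)` with `χ(p_A) = 1`. -/
noncomputable def groupoidQ : EtaleGroupoid (diffSystem S).Germ (Omega S) :=
  (diffSystem S).groupoid

end LCMonoid

/-! ### Hilbert spaces `ℓ²(ι)` -/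

/-- The Hilbert space `ℓ²(ι)`. -/
abbrev Ell2 (ι : Type*) : Type _ := lp (fun _ : ι => ℂ) 2

/-- The standard orthonormal basis vector `δ_i`. -/
noncomputable def delta {ι : Type*} (i : ι) : Ell2 ι := open Classical in lp.single 2 i 1

theorem delta_apply_self {ι : Type*} (i : ι) : delta i i = 1 := by
  classical
  simp [delta]

theorem delta_apply_ne {ι : Type*} {i j : ι} (h : j ≠ i) : delta i j = 0 := by
  classical
  simp [delta, lp.single_apply, h]

theorem inner_delta {ι : Type*} (i : ι) (ξ : Ell2 ι) : inner ℂ (delta i) ξ = ξ i := by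
  classical
  simp [delta, lp.inner_single_left]

theorem orthonormal_delta {ι κ : Type*} (φ : ι → κ) (hφ : Function.Injective φ) :
    Orthonormal ℂ fun i => delta (φ i) := by
  classical
  rw [orthonormal_iff_ite]
  intro i j
  rw [inner_delta]
  split_ifs with h
  · rw [h, delta_apply_self]
  · exact delta_apply_ne fun h' => h (hφ h')

/-- The isometry `ℓ²(ι) → ℓ²(κ)`, `δ_i ↦ δ_{φ i}`, defined by an injective map `φ`. -/
noncomputable def ell2Map {ι κ : Type*} (φ : ι → κ) (hφ : Function.Injective φ) :
    Ell2 ι →ₗᵢ[ℂ] Ell2 κ :=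
  (orthonormal_delta φ hφ).orthogonalFamily.linearIsometry

theorem ell2Map_delta {ι κ : Type*} (φ : ι → κ) (hφ : Function.Injective φ) (i : ι) :
    ell2Map φ hφ (delta i) = delta (φ i) := by
  classical
  unfold ell2Map
  rw [delta, OrthogonalFamily.linearIsometry_apply_single]
  simp

/-- The unitary `ℓ²(ι) → ℓ²(κ)` defined by a bijection `ι → κ`. -/
noncomputable def ell2Congr {ι κ : Type*} (e : ι ≃ κ) : Ell2 ι ≃ₗᵢ[ℂ] Ell2 κ where
  toFun ξ := ⟨fun k => ξ (e.symm k), memℓp_gen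
    ((e.symm.summable_iff (f := fun i => ‖ξ i‖ ^ (2 : ℝ≥0∞).toReal)).2
      ((lp.memℓp ξ).summable (by simp)))⟩
  invFun η := ⟨fun i => η (e i), memℓp_gen
    ((e.summable_iff (f := fun k => ‖η k‖ ^ (2 : ℝ≥0∞).toReal)).2
      ((lp.memℓp η).summable (by simp)))⟩
  left_inv ξ := by ext i; exact congrArg ξ (e.symm_apply_apply i)
  right_inv η := by ext i; exact congrArg η (e.apply_symm_apply i)
  map_add' ξ η := rfl
  map_smul' c ξ := rfl
  norm_map' ξ := by
    rw [lp.norm_eq_tsum_rpow (by simp), lp.norm_eq_tsum_rpow (by simp)]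
    congr 1
    exact e.symm.tsum_eq (fun i => ‖ξ i‖ ^ (2 : ℝ≥0∞).toReal)

theorem ell2Congr_apply {ι κ : Type*} (e : ι ≃ κ) (ξ : Ell2 ι) (k : κ) :
    ell2Congr e ξ k = ξ (e.symm k) := rfl

theorem ell2Congr_delta {ι κ : Type*} (e : ι ≃ κ) (i : ι) :
    ell2Congr e (delta i) = delta (e i) := by
  ext k
  rw [ell2Congr_apply]
  by_cases h : k = e i
  · subst h; rw [e.symm_apply_apply, delta_apply_self, delta_apply_self]
  · rw [delta_apply_ne h, delta_apply_ne]
    rintro rfl; exact h (e.apply_symm_apply k).symm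

/-! ### The reduced and the essential C*-algebras of an étale groupoid -/

namespace EtaleGroupoid

variable {G X : Type*} [TopologicalSpace G] [TopologicalSpace X] (𝒢 : EtaleGroupoid G X)

/-- An open bisection: an open set on which the source and the range maps are injective (and so,
being local homeomorphisms, they are homeomorphisms onto open subsets of the unit space). -/
def IsOpenBisection (U : Set G) : Prop := IsOpen U ∧ InjOn 𝒢.src U ∧ InjOn 𝒢.rng U

/-- The continuous compactly supported functions on an open bisection `U`, extended by zero. -/
def CcOn (U : Set G) : Set (G → ℂ) :=
  {f | ContinuousOn f U ∧ ∃ K, IsCompact K ∧ K ⊆ U ∧ ∀ g ∉ K, f g = 0}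

/-- The space `C_c(𝒢)`: the linear span of `C_c(U)` for all open bisections `U`. -/
def Cc : Submodule ℂ (G → ℂ) := Submodule.span ℂ (⋃ U ∈ {U | 𝒢.IsOpenBisection U}, CcOn U)

/-- The fibre `𝒢_x = s⁻¹(x)`. -/
def Fiber (x : X) : Type _ := {g : G // 𝒢.src g = x}

/-- The element `h⁻¹ g ∈ 𝒢_x`, for `g ∈ 𝒢_x` and `h` with the same range as `g`. -/
def Fiber.div {𝒢 : EtaleGroupoid G X} {x : X} (g : 𝒢.Fiber x)
    (h : {h : G // 𝒢.rng h = 𝒢.rng g.1}) : 𝒢.Fiber x :=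
  ⟨𝒢.mul (𝒢.inv h) g.1 ((𝒢.src_inv _).trans h.2), (𝒢.src_mul _ _ _).trans g.2⟩

/-- The function `g ↦ ∑_{h ∈ 𝒢^{r(g)}} f(h) ξ(h⁻¹ g)` on `𝒢_x`.  (For `f ∈ C_c(𝒢)` the sum has
only finitely many nonzero terms.) -/
noncomputable def conv (f : G → ℂ) {x : X} (ξ : 𝒢.Fiber x → ℂ) (g : 𝒢.Fiber x) : ℂ :=
  ∑ᶠ h : {h : G // 𝒢.rng h = 𝒢.rng g.1}, f h * ξ (g.div h)

/-- The product `g k ∈ 𝒢_x` for `g ∈ 𝒢_{r(k)}` and `k ∈ 𝒢_x`. -/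
def mulRight {x : X} (k : 𝒢.Fiber x) (g : 𝒢.Fiber (𝒢.rng k.1)) : 𝒢.Fiber x :=
  ⟨𝒢.mul g.1 k.1 g.2, (𝒢.src_mul _ _ _).trans k.2⟩

/-- The product `g k⁻¹ ∈ 𝒢_{r(k)}` for `g, k ∈ 𝒢_x`. -/
def divRight {x : X} (k : 𝒢.Fiber x) (g : 𝒢.Fiber x) : 𝒢.Fiber (𝒢.rng k.1) :=
  ⟨𝒢.mul g.1 (𝒢.inv k.1) ((g.2.trans k.2.symm).trans (𝒢.rng_inv _).symm),
    (𝒢.src_mul _ _ _).trans (𝒢.src_inv _)⟩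

variable {𝒢}

theorem mul_congr {g g' h h' : G} (e : g = g') (e' : h = h') (H : 𝒢.src g = 𝒢.rng h) :
    𝒢.mul g h H = 𝒢.mul g' h' (by rw [← e, ← e', H]) := by subst e e'; rfl

theorem mul_inv_cancel_right {g k : G} (H : 𝒢.src g = 𝒢.rng k) :
    𝒢.mul (𝒢.mul g k H) (𝒢.inv k) ((𝒢.src_mul _ _ _).trans (𝒢.rng_inv k).symm) = g := by
  rw [𝒢.mul_assoc g k _ H (𝒢.rng_inv k).symm, mul_congr rfl (𝒢.mul_inv k)]
  exact (mul_congr rfl (congrArg 𝒢.one H.symm) _).trans (𝒢.mul_one g)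

theorem inv_mul_cancel_right {g k : G} (H : 𝒢.src g = 𝒢.src k) :
    𝒢.mul (𝒢.mul g (𝒢.inv k) (H.trans (𝒢.rng_inv k).symm)) k
      ((𝒢.src_mul _ _ _).trans (𝒢.src_inv k)) = g := by
  rw [𝒢.mul_assoc g _ k (H.trans (𝒢.rng_inv k).symm) (𝒢.src_inv k), mul_congr rfl (𝒢.inv_mul k)]
  exact (mul_congr rfl (congrArg 𝒢.one H.symm) _).trans (𝒢.mul_one g)

theorem mul_inv_cancel_left {h g : G} (H : 𝒢.rng h = 𝒢.rng g) :
    𝒢.mul h (𝒢.mul (𝒢.inv h) g ((𝒢.src_inv h).trans H))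
      ((𝒢.rng_inv h).symm.trans (𝒢.rng_mul _ _ _).symm) = g := by
  rw [← 𝒢.mul_assoc h (𝒢.inv h) g (𝒢.rng_inv h).symm, mul_congr (𝒢.mul_inv h) rfl]
  exact (mul_congr (congrArg 𝒢.one H) rfl _).trans (𝒢.one_mul g)

/-- Right multiplication by `k`, as a bijection `𝒢_{r(k)} → 𝒢_x`. -/
def fiberEquiv {x : X} (k : 𝒢.Fiber x) : 𝒢.Fiber (𝒢.rng k.1) ≃ 𝒢.Fiber x where
  toFun := 𝒢.mulRight k
  invFun := 𝒢.divRight k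
  left_inv g := Subtype.ext (mul_inv_cancel_right g.2)
  right_inv g := Subtype.ext (inv_mul_cancel_right (g.2.trans k.2.symm))

theorem conv_congr (f : G → ℂ) {x : X} (k : 𝒢.Fiber x) (ξ : 𝒢.Fiber (𝒢.rng k.1) → ℂ)
    (g : 𝒢.Fiber x) :
    𝒢.conv f (fun g' => ξ (𝒢.divRight k g')) g = 𝒢.conv f ξ (𝒢.divRight k g) := by
  have hr : 𝒢.rng (𝒢.divRight k g).1 = 𝒢.rng g.1 := 𝒢.rng_mul _ _ _
  unfold conv
  rw [← finsum_comp_equiv (Equiv.subtypeEquivRight fun h => by rw [hr] :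
    {h : G // 𝒢.rng h = 𝒢.rng g.1} ≃ {h : G // 𝒢.rng h = 𝒢.rng (𝒢.divRight k g).1})]
  refine finsum_congr fun h => ?_
  exact congrArg (fun z => f h.1 * ξ z) (Subtype.ext (𝒢.mul_assoc _ _ _ _ _))

theorem div_eq_iff {x : X} (g k : 𝒢.Fiber x) (h : {h : G // 𝒢.rng h = 𝒢.rng g.1}) :
    g.div h = k ↔ h.1 = (𝒢.divRight k g).1 := by
  constructor
  · rintro rfl
    have h1 := mul_inv_cancel_left h.2
    have h2 : 𝒢.src h.1 = 𝒢.rng (g.div h).1 := (𝒢.rng_inv _).symm.trans (𝒢.rng_mul _ _ _).symm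
    exact (mul_inv_cancel_right h2).symm.trans (mul_congr h1 rfl _)
  · intro e
    have h2 : 𝒢.src h.1 = 𝒢.rng k.1 := by rw [e]; exact (𝒢.divRight k g).2
    have h3 : 𝒢.mul h.1 k.1 h2 = g.1 :=
      (mul_congr e rfl _).trans (inv_mul_cancel_right (g.2.trans k.2.symm))
    refine Subtype.ext ?_
    refine (mul_congr rfl h3.symm _).trans ?_
    rw [← 𝒢.mul_assoc _ _ _ (𝒢.src_inv _), mul_congr (𝒢.inv_mul h.1) rfl]
    exact (mul_congr (congrArg 𝒢.one h2) rfl _).trans (𝒢.one_mul _)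

theorem conv_delta (f : G → ℂ) {x : X} (k g : 𝒢.Fiber x) :
    𝒢.conv f (delta k) g = f (𝒢.divRight k g).1 := by
  have hr : 𝒢.rng (𝒢.divRight k g).1 = 𝒢.rng g.1 := 𝒢.rng_mul _ _ _
  unfold conv
  rw [finsum_eq_single _ ⟨(𝒢.divRight k g).1, hr⟩]
  · rw [(div_eq_iff g k ⟨_, hr⟩).2 rfl, delta_apply_self, _root_.mul_one]
  · intro h hne
    rw [delta_apply_ne, mul_zero]
    exact fun e => hne (Subtype.ext ((div_eq_iff g k h).1 e))

/-- Only finitely many values of `f` on each set `𝒢^y` are nonzero. -/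
def FinFib (𝒢 : EtaleGroupoid G X) (f : G → ℂ) : Prop :=
  ∀ y, {h : {h : G // 𝒢.rng h = y} | f h ≠ 0}.Finite

theorem FinFib.finite_support {f : G → ℂ} (hf : 𝒢.FinFib f) {x : X} (ξ : 𝒢.Fiber x → ℂ)
    (g : 𝒢.Fiber x) :
    (Function.support fun h : {h : G // 𝒢.rng h = 𝒢.rng g.1} => f h * ξ (g.div h)).Finite :=
  (hf _).subset fun _ hh => left_ne_zero_of_mul hh

theorem conv_add_left {f f' : G → ℂ} (hf : 𝒢.FinFib f) (hf' : 𝒢.FinFib f') {x : X}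
    (ξ : 𝒢.Fiber x → ℂ) (g : 𝒢.Fiber x) :
    𝒢.conv (f + f') ξ g = 𝒢.conv f ξ g + 𝒢.conv f' ξ g := by
  unfold conv
  rw [← finsum_add_distrib (hf.finite_support ξ g) (hf'.finite_support ξ g)]
  exact finsum_congr fun h => add_mul _ _ _

theorem conv_smul_left (f : G → ℂ) (c : ℂ) {x : X}
    (ξ : 𝒢.Fiber x → ℂ) (g : 𝒢.Fiber x) :
    𝒢.conv (c • f) ξ g = c * 𝒢.conv f ξ g := by
  unfold conv
  exact (finsum_congr fun h => _root_.mul_assoc _ _ _).trans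
    (mul_finsum _ c).symm

theorem conv_add_right {f : G → ℂ} (hf : 𝒢.FinFib f) {x : X}
    (ξ η : 𝒢.Fiber x → ℂ) (g : 𝒢.Fiber x) :
    𝒢.conv f (ξ + η) g = 𝒢.conv f ξ g + 𝒢.conv f η g := by
  unfold conv
  rw [← finsum_add_distrib (hf.finite_support ξ g) (hf.finite_support η g)]
  exact finsum_congr fun h => mul_add _ _ _

theorem conv_smul_right (f : G → ℂ) (c : ℂ) {x : X}
    (ξ : 𝒢.Fiber x → ℂ) (g : 𝒢.Fiber x) :
    𝒢.conv f (c • ξ) g = c * 𝒢.conv f ξ g := by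
  unfold conv
  exact (finsum_congr fun h => mul_left_comm _ _ _).trans
    (mul_finsum _ c).symm

theorem finFib_of_mem_CcOn {U : Set G} (hU : 𝒢.IsOpenBisection U) {f : G → ℂ} (hf : f ∈ CcOn U) :
    𝒢.FinFib f := by
  obtain ⟨-, K, -, hKU, hK⟩ := hf
  intro y
  refine Set.Subsingleton.finite ?_
  rintro ⟨h, hh⟩ h1 ⟨k, hk⟩ h2
  have a1 : h ∈ U := hKU (by_contra fun hn => h1 (hK _ hn))
  have a2 : k ∈ U := hKU (by_contra fun hn => h2 (hK _ hn))
  exact Subtype.ext (hU.2.2 a1 a2 (hh.trans hk.symm))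

theorem sum_conv_le {U : Set G} (hU : 𝒢.IsOpenBisection U) {f : G → ℂ} (hf : f ∈ CcOn U) {C : ℝ}
    (hC : ∀ g, ‖f g‖ ≤ C) {x : X} (ξ : Ell2 (𝒢.Fiber x)) (s : Finset (𝒢.Fiber x)) :
    ∑ g ∈ s, ‖𝒢.conv f ξ g‖ ^ (2 : ℝ≥0∞).toReal ≤ (C * ‖ξ‖) ^ (2 : ℝ≥0∞).toReal := by
  classical
  obtain ⟨-, K, -, hKU, hK⟩ := hf
  have hC0 : 0 ≤ C ∨ IsEmpty G := by
    by_cases h : Nonempty G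
    · exact .inl ((norm_nonneg _).trans (hC h.some))
    · exact .inr (not_nonempty_iff.1 h)
  rcases hC0 with hC0 | hG
  swap
  · have : IsEmpty (𝒢.Fiber x) := ⟨fun g => hG.false g.1⟩
    have hs : s = ∅ := Finset.eq_empty_of_isEmpty s
    rw [hs, lp.eq_zero' ξ]; simp
  have hval : ∀ (g : 𝒢.Fiber x) (h : {h : G // 𝒢.rng h = 𝒢.rng g.1}), h.1 ∈ U →
      𝒢.conv f ξ g = f h * ξ (g.div h) := by
    intro g h hh
    refine finsum_eq_single _ h fun k hne => ?_
    have : k.1 ∉ K := fun hk => hne (Subtype.ext (hU.2.2 (hKU hk) hh (k.2.trans h.2.symm)))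
    rw [hK _ this, zero_mul]
  have hval0 : ∀ g : 𝒢.Fiber x, (¬ ∃ h : {h : G // 𝒢.rng h = 𝒢.rng g.1}, h.1 ∈ U) →
      𝒢.conv f ξ g = 0 := by
    intro g hg
    refine finsum_eq_zero_of_forall_eq_zero fun k => ?_
    have : k.1 ∉ K := fun hk => hg ⟨k, hKU hk⟩
    rw [hK _ this, zero_mul]
  let A : 𝒢.Fiber x → Prop := fun g => ∃ h : {h : G // 𝒢.rng h = 𝒢.rng g.1}, h.1 ∈ U
  let φ : 𝒢.Fiber x → 𝒢.Fiber x := fun g => if h : A g then g.div h.choose else g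
  have hφ : ∀ g ∈ s.filter A, ∀ g' ∈ s.filter A, φ g = φ g' → g = g' := by
    intro g hg g' hg' e
    have ha := (Finset.mem_filter.1 hg).2
    have ha' := (Finset.mem_filter.1 hg').2
    simp only [φ, ha, ha', ↓reduceDIte] at e
    have e1 : 𝒢.src ha.choose.1 = 𝒢.src ha'.choose.1 := by
      have h2 : ∀ (g : 𝒢.Fiber x) h, 𝒢.rng (g.div h).1 = 𝒢.src h.1 := fun g h =>
        (𝒢.rng_mul _ _ _).trans (𝒢.rng_inv _)
      rw [← h2, ← h2, e]
    have e2 : ha.choose.1 = ha'.choose.1 := hU.2.1 ha.choose_spec ha'.choose_spec e1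
    refine Subtype.ext ?_
    rw [← mul_inv_cancel_left ha.choose.2, ← mul_inv_cancel_left ha'.choose.2]
    exact mul_congr e2 (congrArg Subtype.val e) _
  have h2 : (2 : ℝ≥0∞).toReal = 2 := by simp
  calc ∑ g ∈ s, ‖𝒢.conv f ξ g‖ ^ (2 : ℝ≥0∞).toReal
      = ∑ g ∈ s.filter A, ‖𝒢.conv f ξ g‖ ^ (2 : ℝ≥0∞).toReal := by
        rw [Finset.sum_filter_of_ne]
        intro g _ hne
        by_contra hA
        rw [hval0 g hA] at hne
        simp at hne
    _ ≤ ∑ g ∈ s.filter A, C ^ (2 : ℝ≥0∞).toReal * ‖ξ (φ g)‖ ^ (2 : ℝ≥0∞).toReal := by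
        refine Finset.sum_le_sum fun g hg => ?_
        have ha := (Finset.mem_filter.1 hg).2
        rw [← Real.mul_rpow hC0 (norm_nonneg _)]
        refine Real.rpow_le_rpow (norm_nonneg _) ?_ (by simp)
        rw [hval g _ ha.choose_spec, norm_mul]
        simp only [φ, ha, ↓reduceDIte]
        exact mul_le_mul_of_nonneg_right (hC _) (norm_nonneg _)
    _ = C ^ (2 : ℝ≥0∞).toReal * ∑ k ∈ (s.filter A).image φ, ‖ξ k‖ ^ (2 : ℝ≥0∞).toReal := by
        rw [← Finset.mul_sum, Finset.sum_image hφ]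
    _ ≤ C ^ (2 : ℝ≥0∞).toReal * ‖ξ‖ ^ (2 : ℝ≥0∞).toReal :=
        mul_le_mul_of_nonneg_left (lp.sum_rpow_le_norm_rpow (by simp) ξ _)
          (Real.rpow_nonneg hC0 _)
    _ = (C * ‖ξ‖) ^ (2 : ℝ≥0∞).toReal := (Real.mul_rpow hC0 (norm_nonneg _)).symm

theorem exists_rho_of_mem_CcOn {U : Set G} (hU : 𝒢.IsOpenBisection U) {f : G → ℂ}
    (hf : f ∈ CcOn U) : ∃ C : ℝ, 0 ≤ C ∧ ∀ x : X,
      ∃ T : Ell2 (𝒢.Fiber x) →L[ℂ] Ell2 (𝒢.Fiber x), ‖T‖ ≤ C ∧ ∀ ξ g, T ξ g = 𝒢.conv f ξ g := by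
  have hff := finFib_of_mem_CcOn hU hf
  obtain ⟨C, hC0, hC⟩ : ∃ C : ℝ, 0 ≤ C ∧ ∀ g, ‖f g‖ ≤ C := by
    obtain ⟨hc, K, hK, hKU, hK0⟩ := hf
    obtain ⟨C, hC⟩ := hK.exists_bound_of_continuousOn (hc.mono hKU)
    refine ⟨max C 0, le_max_right _ _, fun g => ?_⟩
    by_cases hg : g ∈ K
    · exact (hC g hg).trans (le_max_left _ _)
    · rw [hK0 g hg, norm_zero]; exact le_max_right _ _
  refine ⟨C, hC0, fun x => ?_⟩
  have hmem : ∀ ξ : Ell2 (𝒢.Fiber x), Memℓp (𝒢.conv f ξ) 2 :=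
    fun ξ => memℓp_gen' (sum_conv_le hU hf hC ξ)
  let T : Ell2 (𝒢.Fiber x) →ₗ[ℂ] Ell2 (𝒢.Fiber x) :=
    { toFun := fun ξ => ⟨𝒢.conv f ξ, hmem ξ⟩
      map_add' := fun ξ η => by ext g; exact conv_add_right hff _ _ g
      map_smul' := fun c ξ => by ext g; exact conv_smul_right _ c _ g }
  have hT : ∀ ξ, ‖T ξ‖ ≤ C * ‖ξ‖ := fun ξ =>
    lp.norm_le_of_forall_sum_le (by simp) (mul_nonneg hC0 (norm_nonneg _))
      (sum_conv_le hU hf hC ξ)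
  exact ⟨T.mkContinuous C hT, T.mkContinuous_norm_le hC0 hT, fun ξ g => rfl⟩

theorem exists_rho {f : G → ℂ} (hf : f ∈ 𝒢.Cc) : 𝒢.FinFib f ∧ ∃ C : ℝ, 0 ≤ C ∧ ∀ x : X,
      ∃ T : Ell2 (𝒢.Fiber x) →L[ℂ] Ell2 (𝒢.Fiber x), ‖T‖ ≤ C ∧ ∀ ξ g, T ξ g = 𝒢.conv f ξ g := by
  induction hf using Submodule.span_induction with
  | mem f hf =>
    simp only [mem_iUnion, mem_ofPred_eq, exists_prop] at hf
    obtain ⟨U, hU, hf⟩ := hf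
    exact ⟨finFib_of_mem_CcOn hU hf, exists_rho_of_mem_CcOn hU hf⟩
  | zero =>
    refine ⟨fun y => by simp, 0, le_rfl, fun x => ⟨0, by simp, fun ξ g => ?_⟩⟩
    simp [conv]
  | add f f' _ _ h h' =>
    obtain ⟨hf, C, hC, H⟩ := h
    obtain ⟨hf', C', hC', H'⟩ := h'
    refine ⟨fun y => ((hf y).union (hf' y)).subset fun h hh => ?_, C + C', add_nonneg hC hC',
      fun x => ?_⟩
    · by_contra hn
      simp only [mem_union, mem_ofPred_eq, not_or, not_not] at hn
      exact hh (by rw [Pi.add_apply, hn.1, hn.2, add_zero])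
    · obtain ⟨T, hT, hTf⟩ := H x
      obtain ⟨T', hT', hTf'⟩ := H' x
      refine ⟨T + T', (norm_add_le _ _).trans (add_le_add hT hT'), fun ξ g => ?_⟩
      rw [conv_add_left hf hf', ← hTf, ← hTf']; rfl
  | smul c f _ h =>
    obtain ⟨hf, C, hC, H⟩ := h
    refine ⟨fun y => (hf y).subset fun h hh => right_ne_zero_of_mul hh, ‖c‖ * C,
      mul_nonneg (norm_nonneg _) hC, fun x => ?_⟩
    obtain ⟨T, hT, hTf⟩ := H x
    refine ⟨c • T, (norm_smul_le _ _).trans (mul_le_mul_of_nonneg_left hT (norm_nonneg _)),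
      fun ξ g => ?_⟩
    rw [conv_smul_left _, ← hTf]; rfl

variable (𝒢)

/-- The operator `ρ_x(f)` on `ℓ²(𝒢_x)`, for `f ∈ C_c(𝒢)`; it is determined by `rho_apply`. -/
noncomputable def rho (x : X) (f : 𝒢.Cc) : Ell2 (𝒢.Fiber x) →L[ℂ] Ell2 (𝒢.Fiber x) :=
  ((exists_rho f.2).2.choose_spec.2 x).choose

/-- `(ρ_x(f) ξ)(g) = ∑_{h ∈ 𝒢^{r(g)}} f(h) ξ(h⁻¹ g)`. -/
theorem rho_apply (x : X) (f : 𝒢.Cc) (ξ : Ell2 (𝒢.Fiber x)) (g : 𝒢.Fiber x) :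
    𝒢.rho x f ξ g = 𝒢.conv f ξ g :=
  ((exists_rho f.2).2.choose_spec.2 x).choose_spec.2 ξ g

theorem bddAbove_norm_rho (f : 𝒢.Cc) : BddAbove (range fun x => ‖𝒢.rho x f‖) := by
  refine ⟨(exists_rho f.2).2.choose, ?_⟩
  rintro _ ⟨x, rfl⟩
  exact ((exists_rho f.2).2.choose_spec.2 x).choose_spec.1

/-- The C*-algebra of bounded families `(T_x)_x` of operators `T_x` on `ℓ²(𝒢_x)`, `x ∈ 𝒢⁽⁰⁾`, with
the supremum norm and pointwise operations. -/
def Families : Type _ := lp (fun x : X => Ell2 (𝒢.Fiber x) →L[ℂ] Ell2 (𝒢.Fiber x)) ∞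

noncomputable instance : NonUnitalCStarAlgebra 𝒢.Families :=
  inferInstanceAs (NonUnitalCStarAlgebra
    (lp (fun x : X => Ell2 (𝒢.Fiber x) →L[ℂ] Ell2 (𝒢.Fiber x)) ∞))

/-- The family `(ρ_x(f))_x`, whose norm is `‖f‖_r = sup_x ‖ρ_x(f)‖`. -/
noncomputable def regRep (f : 𝒢.Cc) : 𝒢.Families :=
  ⟨fun x => 𝒢.rho x f, memℓp_infty (𝒢.bddAbove_norm_rho f)⟩

/-- The reduced C*-algebra `C*_r(𝒢)`: the completion of `C_c(𝒢)` with respect to the norm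
`‖f‖_r = sup_x ‖ρ_x(f)‖`, realised as the C*-algebra generated by the families `(ρ_x(f))_x`,
`f ∈ C_c(𝒢)`. -/
noncomputable def reducedAlgebra : NonUnitalStarSubalgebra ℂ 𝒢.Families :=
  (NonUnitalStarAlgebra.adjoin ℂ (range 𝒢.regRep)).topologicalClosure

/-- The representation `ρ_x`, as the `x`-th component map. -/
noncomputable def rhoHom (x : X) :
    𝒢.Families →⋆ₙₐ[ℂ] (Ell2 (𝒢.Fiber x) →L[ℂ] Ell2 (𝒢.Fiber x)) where
  toFun a := a.1 x
  map_smul' _ _ := rfl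
  map_zero' := rfl
  map_add' _ _ := rfl
  map_mul' _ _ := rfl
  map_star' _ := rfl

/-- The unit `x`, as an element of `𝒢_x`. -/
def unitAt (x : X) : 𝒢.Fiber x := ⟨𝒢.one x, 𝒢.src_one x⟩

/-- The set of `x ∈ 𝒢⁽⁰⁾` with `ρ_x(a) δ_x ≠ 0`. -/
def singSupport (a : 𝒢.Families) : Set X := {x | 𝒢.rhoHom x a (delta (𝒢.unitAt x)) ≠ 0}

theorem continuous_rhoHom (x : X) : Continuous (𝒢.rhoHom x) :=
  (lp.evalCLM ℂ (fun x : X => Ell2 (𝒢.Fiber x) →L[ℂ] Ell2 (𝒢.Fiber x)) ∞ x).continuous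

theorem rhoHom_regRep (x : X) (f : 𝒢.Cc) : 𝒢.rhoHom x (𝒢.regRep f) = 𝒢.rho x f := rfl

theorem families_ext {a b : 𝒢.Families} (h : ∀ x, 𝒢.rhoHom x a = 𝒢.rhoHom x b) : a = b :=
  lp.ext (funext h)

theorem regRep_add (f f' : 𝒢.Cc) : 𝒢.regRep (f + f') = 𝒢.regRep f + 𝒢.regRep f' := by
  refine 𝒢.families_ext fun x => ?_
  rw [map_add, rhoHom_regRep, rhoHom_regRep, rhoHom_regRep]
  ext ξ g
  exact (𝒢.rho_apply _ _ _ _).trans ((conv_add_left (exists_rho f.2).1 (exists_rho f'.2).1 ξ g).trans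
    (congrArg₂ _ (𝒢.rho_apply _ _ _ _) (𝒢.rho_apply _ _ _ _)).symm)

theorem regRep_smul (c : ℂ) (f : 𝒢.Cc) : 𝒢.regRep (c • f) = c • 𝒢.regRep f := by
  refine 𝒢.families_ext fun x => ?_
  rw [map_smul, rhoHom_regRep, rhoHom_regRep]
  ext ξ g
  exact (𝒢.rho_apply _ _ _ _).trans ((conv_smul_left _ c ξ g).trans
    (congrArg _ (𝒢.rho_apply _ _ _ _)).symm)

theorem inv_one (x : X) : 𝒢.inv (𝒢.one x) = 𝒢.one x := by
  have h1 := 𝒢.mul_one (𝒢.inv (𝒢.one x))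
  have h2 := 𝒢.inv_mul (𝒢.one x)
  have h3 : 𝒢.one (𝒢.src (𝒢.inv (𝒢.one x))) = 𝒢.one x :=
    congrArg 𝒢.one ((𝒢.src_inv _).trans (𝒢.rng_one x))
  rw [← h1, mul_congr rfl h3, h2, 𝒢.src_one]

theorem inv_inv (k : G) : 𝒢.inv (𝒢.inv k) = k := by
  have e1 := 𝒢.mul_assoc k (𝒢.inv k) (𝒢.inv (𝒢.inv k)) (𝒢.rng_inv k).symm
    (𝒢.rng_inv (𝒢.inv k)).symm
  have e2 := 𝒢.mul_inv (𝒢.inv k)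
  have e3 := 𝒢.mul_one k
  have e4 := 𝒢.one_mul (𝒢.inv (𝒢.inv k))
  have h1 : 𝒢.rng (𝒢.inv k) = 𝒢.src k := 𝒢.rng_inv k
  have h2 : 𝒢.rng k = 𝒢.rng (𝒢.inv (𝒢.inv k)) := by rw [𝒢.rng_inv, 𝒢.src_inv]
  rw [← e4]
  refine (mul_congr ((congrArg 𝒢.one h2.symm).trans (𝒢.mul_inv k).symm) rfl _).trans (e1.trans ?_)
  exact (mul_congr rfl (e2.trans (congrArg 𝒢.one h1)) _).trans e3

theorem mulRight_unitAt {x : X} (k : 𝒢.Fiber x) :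
    fiberEquiv k (𝒢.unitAt (𝒢.rng k.1)) = k := Subtype.ext (𝒢.one_mul k.1)

theorem divRight_unitAt {x : X} (g : 𝒢.Fiber x) : (𝒢.divRight (𝒢.unitAt x) g).1 = g.1 :=
  (mul_congr rfl ((𝒢.inv_one x).trans (congrArg 𝒢.one g.2.symm)) _).trans (𝒢.mul_one g.1)

theorem unitAt_divRight {x : X} (g : 𝒢.Fiber x) :
    (𝒢.divRight g (𝒢.unitAt x)).1 = 𝒢.inv g.1 := by
  have h : 𝒢.one x = 𝒢.one (𝒢.rng (𝒢.inv g.1)) := by rw [𝒢.rng_inv, g.2]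
  exact (mul_congr h rfl _).trans (𝒢.one_mul (𝒢.inv g.1))

theorem rhoHom_delta {a : 𝒢.Families} (ha : a ∈ 𝒢.reducedAlgebra) {x : X} (k : 𝒢.Fiber x) :
    𝒢.rhoHom x a (delta k) = ell2Congr (fiberEquiv k)
      (𝒢.rhoHom (𝒢.rng k.1) a (delta (𝒢.unitAt (𝒢.rng k.1)))) := by
  let W := ell2Congr (fiberEquiv k)
  let ψ : 𝒢.Families →⋆ₙₐ[ℂ] (Ell2 (𝒢.Fiber x) →L[ℂ] Ell2 (𝒢.Fiber x)) :=
    (W.conjStarAlgEquiv : _ →⋆ₙₐ[ℂ] _).comp (𝒢.rhoHom (𝒢.rng k.1))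
  have hψ : ∀ (b : 𝒢.Families) (ξ), ψ b (W ξ) = W (𝒢.rhoHom (𝒢.rng k.1) b ξ) := by
    intro b ξ
    have h1 : ψ b (W ξ) = W (𝒢.rhoHom (𝒢.rng k.1) b (W.symm (W ξ))) := rfl
    rw [h1, W.symm_apply_apply]
  have hc : Continuous ψ := by
    have : Isometry W.conjStarAlgEquiv := NonUnitalStarAlgHom.isometry _ W.conjStarAlgEquiv.injective
    exact this.continuous.comp (𝒢.continuous_rhoHom _)
  have hle : 𝒢.reducedAlgebra ≤ NonUnitalStarAlgHom.equalizer (𝒢.rhoHom x) ψ := by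
    refine NonUnitalStarSubalgebra.topologicalClosure_minimal _ (NonUnitalStarAlgebra.adjoin_le ?_)
      (isClosed_eq (𝒢.continuous_rhoHom x) hc)
    rintro _ ⟨f, rfl⟩
    refine (NonUnitalStarAlgHom.mem_equalizer _ _ _).2 (ContinuousLinearMap.ext fun η => ?_)
    obtain ⟨ξ, rfl⟩ := W.surjective η
    rw [hψ, rhoHom_regRep, rhoHom_regRep]
    ext g
    rw [rho_apply]
    exact (conv_congr f k ξ g).trans (𝒢.rho_apply _ _ _ _).symm
  have h := (NonUnitalStarAlgHom.mem_equalizer _ _ _).1 (hle ha)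
  rw [h]
  have h2 : delta k = W (delta (𝒢.unitAt (𝒢.rng k.1))) := by
    rw [ell2Congr_delta, mulRight_unitAt]
  rw [h2, hψ]

/-- The right multipliers `b` of the set of elements with meager `singSupport`. -/
def IsGood (b : 𝒢.Families) : Prop := ∀ a ∈ 𝒢.reducedAlgebra,
  IsMeagre (𝒢.singSupport a) → IsMeagre (𝒢.singSupport (a * b))

theorem isGood_of_bisection {T : 𝒢.Families} {U : Set G} (hU : IsOpen U) {p q : G → X}
    (hp : IsLocalHomeomorph p) (hq : IsLocalHomeomorph q) (hinj : InjOn p U)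
    (H : ∀ x, 𝒢.rhoHom x T (delta (𝒢.unitAt x)) = 0 ∨ ∃ g ∈ U, p g = x ∧ ∃ k : 𝒢.Fiber x,
      𝒢.rng k.1 = q g ∧ ∃ c : ℂ, 𝒢.rhoHom x T (delta (𝒢.unitAt x)) = c • delta k) :
    𝒢.IsGood T := by
  intro a ha hm
  have h1 : IsMeagre ((fun u : U => q u) ⁻¹' 𝒢.singSupport a) :=
    hm.preimage_of_isOpenMap (hq.continuous.comp continuous_subtype_val)
      (hq.isOpenMap.comp hU.isOpenMap_subtype_val)
  have hemb : IsOpenEmbedding fun u : U => p u :=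
    .of_continuous_injective_isOpenMap (hp.continuous.comp continuous_subtype_val)
      (fun u v h => Subtype.ext (hinj u.2 v.2 h)) (hp.isOpenMap.comp hU.isOpenMap_subtype_val)
  refine (hemb.isInducing.isMeagre_image h1).mono fun x hx => ?_
  have hx' : 𝒢.rhoHom x a (𝒢.rhoHom x T (delta (𝒢.unitAt x))) ≠ 0 := by
    have : 𝒢.rhoHom x (a * T) (delta (𝒢.unitAt x)) ≠ 0 := hx
    rwa [map_mul] at this
  rcases H x with h | ⟨g, hg, hgx, k, hk, c, h⟩
  · rw [h, map_zero] at hx'; exact absurd rfl hx'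
  · rw [h, map_smul, 𝒢.rhoHom_delta ha] at hx'
    refine ⟨⟨g, hg⟩, ?_, hgx⟩
    change 𝒢.rhoHom (q g) a (delta (𝒢.unitAt (q g))) ≠ 0
    rw [← hk]
    intro h0
    rw [h0, map_zero, smul_zero] at hx'
    exact hx' rfl

theorem singSupport_add (a b : 𝒢.Families) :
    𝒢.singSupport (a + b) ⊆ 𝒢.singSupport a ∪ 𝒢.singSupport b := by
  intro x hx
  by_contra hn
  simp only [mem_union, singSupport, mem_ofPred_eq, not_or, not_not] at hn
  refine hx ?_
  rw [map_add, _root_.add_apply, hn.1, hn.2, add_zero]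

theorem singSupport_smul (c : ℂ) (a : 𝒢.Families) :
    𝒢.singSupport (c • a) ⊆ 𝒢.singSupport a := by
  intro x hx h
  refine hx ?_
  rw [map_smul, _root_.smul_apply, h, smul_zero]

theorem singSupport_mul (a b : 𝒢.Families) :
    𝒢.singSupport (a * b) ⊆ 𝒢.singSupport b := by
  intro x hx h
  refine hx ?_
  rw [map_mul, mul_apply_eq_comp, h, map_zero]

theorem singSupport_zero : 𝒢.singSupport 0 = ∅ := by
  ext x; simp [singSupport]

theorem singSupport_star (a : 𝒢.Families) :
    𝒢.singSupport (star a) ⊆ 𝒢.singSupport (a * star a) := by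
  intro x hx h
  refine hx ?_
  rw [map_mul, mul_apply_eq_comp] at h
  rw [← inner_self_eq_zero (𝕜 := ℂ)]
  conv_lhs => rw [map_star, ContinuousLinearMap.star_eq_adjoint,
    ContinuousLinearMap.adjoint_inner_left, ← ContinuousLinearMap.star_eq_adjoint, ← map_star, h,
    inner_zero_right]

theorem isGood_add {b b' : 𝒢.Families} (h : 𝒢.IsGood b) (h' : 𝒢.IsGood b') :
    𝒢.IsGood (b + b') := fun a ha hm => by
  rw [mul_add]
  exact ((h a ha hm).union (h' a ha hm)).mono (𝒢.singSupport_add _ _)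

theorem isGood_smul (c : ℂ) {b : 𝒢.Families} (h : 𝒢.IsGood b) : 𝒢.IsGood (c • b) :=
  fun a ha hm => by
  rw [mul_smul_comm]
  exact (h a ha hm).mono (𝒢.singSupport_smul _ _)

theorem isGood_zero : 𝒢.IsGood 0 := fun a _ _ => by
  rw [mul_zero, singSupport_zero]; exact IsMeagre.empty

theorem isGood_regRep_of_mem_CcOn {U : Set G} (hU : 𝒢.IsOpenBisection U) {f : G → ℂ}
    (hf : f ∈ CcOn U) (hf' : f ∈ 𝒢.Cc) :
    𝒢.IsGood (𝒢.regRep ⟨f, hf'⟩) ∧ 𝒢.IsGood (star (𝒢.regRep ⟨f, hf'⟩)) := by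
  have hfU : ∀ g, f g ≠ 0 → g ∈ U := by
    obtain ⟨-, K, -, hKU, hK⟩ := hf
    exact fun g hg => hKU (by_contra fun hn => hg (hK g hn))
  constructor
  · refine 𝒢.isGood_of_bisection hU.1 𝒢.isLocalHomeomorph_src 𝒢.isLocalHomeomorph_rng hU.2.1
      fun x => ?_
    have hv : ∀ g : 𝒢.Fiber x, 𝒢.rho x ⟨f, hf'⟩ (delta (𝒢.unitAt x)) g = f g.1 := fun g => by
      rw [rho_apply, conv_delta, divRight_unitAt]
    rw [rhoHom_regRep]
    by_cases hk : ∃ k : 𝒢.Fiber x, k.1 ∈ U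
    · obtain ⟨k, hk⟩ := hk
      refine .inr ⟨k.1, hk, k.2, k, rfl, f k.1, ?_⟩
      ext g
      rw [hv, lp.coeFn_smul, Pi.smul_apply]
      by_cases hgk : g = k
      · subst hgk; rw [delta_apply_self]; simp
      · rw [delta_apply_ne hgk, smul_zero]
        by_contra hne
        exact hgk (Subtype.ext (hU.2.1 (hfU _ hne) hk (g.2.trans k.2.symm)))
    · refine .inl ?_
      ext g
      rw [hv]
      by_contra hne
      exact hk ⟨g, hfU _ hne⟩
  · refine 𝒢.isGood_of_bisection hU.1 𝒢.isLocalHomeomorph_rng 𝒢.isLocalHomeomorph_src hU.2.2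
      fun x => ?_
    have hv : ∀ g : 𝒢.Fiber x, (star (𝒢.rho x ⟨f, hf'⟩)) (delta (𝒢.unitAt x)) g =
        star (f (𝒢.inv g.1)) := fun g => by
      rw [← inner_delta, ContinuousLinearMap.star_eq_adjoint,
        ContinuousLinearMap.adjoint_inner_right, ← inner_conj_symm, inner_delta, rho_apply,
        conv_delta, unitAt_divRight]
      rfl
    rw [map_star, rhoHom_regRep]
    by_cases hk : ∃ h ∈ U, 𝒢.rng h = x
    · obtain ⟨h, hh, hx⟩ := hk
      refine .inr ⟨h, hh, hx, ⟨𝒢.inv h, (𝒢.src_inv h).trans hx⟩, 𝒢.rng_inv h, star (f h), ?_⟩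
      ext g
      rw [hv, lp.coeFn_smul, Pi.smul_apply]
      by_cases hgk : g = ⟨𝒢.inv h, (𝒢.src_inv h).trans hx⟩
      · have h1 : delta g g = 1 := delta_apply_self g
        rw [hgk] at h1 ⊢
        rw [h1, smul_eq_mul, _root_.mul_one]
        exact congrArg (fun z => star (f z)) (𝒢.inv_inv h)
      · rw [delta_apply_ne hgk, smul_zero]
        by_contra hne
        have hne' : f (𝒢.inv g.1) ≠ 0 := fun h0 => hne (by rw [h0, star_zero])
        have := hU.2.2 (hfU _ hne') hh (((𝒢.rng_inv _).trans g.2).trans hx.symm)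
        refine hgk (Subtype.ext ?_)
        change g.1 = 𝒢.inv h
        rw [← this, inv_inv]
    · refine .inl ?_
      ext g
      rw [hv]
      by_contra hne
      have hne' : f (𝒢.inv g.1) ≠ 0 := fun h0 => hne (by rw [h0, star_zero]; rfl)
      exact hk ⟨_, hfU _ hne', (𝒢.rng_inv _).trans g.2⟩

theorem isGood_regRep (f : 𝒢.Cc) : 𝒢.IsGood (𝒢.regRep f) ∧ 𝒢.IsGood (star (𝒢.regRep f)) := by
  obtain ⟨f, hf⟩ := f
  induction hf using Submodule.span_induction with
  | mem f h =>
    have h' := h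
    simp only [mem_iUnion, mem_ofPred_eq, exists_prop] at h'
    obtain ⟨U, hU, hf⟩ := h'
    exact 𝒢.isGood_regRep_of_mem_CcOn hU hf _
  | zero =>
    have : 𝒢.regRep ⟨0, zero_mem _⟩ = 0 := by
      have := 𝒢.regRep_smul 0 0
      rwa [zero_smul, zero_smul] at this
    rw [this, star_zero]
    exact ⟨𝒢.isGood_zero, 𝒢.isGood_zero⟩
  | add f f' hf hf' h h' =>
    have := 𝒢.regRep_add ⟨f, hf⟩ ⟨f', hf'⟩
    have e : 𝒢.regRep ⟨f + f', add_mem hf hf'⟩ = _ := this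
    rw [e, star_add]
    exact ⟨𝒢.isGood_add h.1 h'.1, 𝒢.isGood_add h.2 h'.2⟩
  | smul c f hf h =>
    have := 𝒢.regRep_smul c ⟨f, hf⟩
    have e : 𝒢.regRep ⟨c • f, Submodule.smul_mem _ c hf⟩ = _ := this
    rw [e, star_smul]
    exact ⟨𝒢.isGood_smul _ h.1, 𝒢.isGood_smul _ h.2⟩

theorem isGood_of_mem {b : 𝒢.Families} (hb : b ∈ 𝒢.reducedAlgebra) : 𝒢.IsGood b := by
  have h1 : ∀ b ∈ NonUnitalStarAlgebra.adjoin ℂ (range 𝒢.regRep), 𝒢.IsGood b := by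
    intro b hb
    rw [← SetLike.mem_coe, ← NonUnitalStarSubalgebra.coe_toNonUnitalSubalgebra,
      NonUnitalStarAlgebra.adjoin_toNonUnitalSubalgebra, SetLike.mem_coe] at hb
    induction hb using NonUnitalAlgebra.adjoin_induction with
    | mem b hb =>
      rcases (mem_union _ _ _).1 hb with ⟨f, rfl⟩ | hf
      · exact (𝒢.isGood_regRep f).1
      · obtain ⟨f, hf⟩ := Set.mem_star.1 hf
        rw [← star_star b, ← hf]; exact (𝒢.isGood_regRep f).2
    | add b b' hb hb' h h' => exact 𝒢.isGood_add h h'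
    | zero => exact 𝒢.isGood_zero
    | mul b b' hb hb' h h' =>
      rw [← NonUnitalStarAlgebra.adjoin_toNonUnitalSubalgebra] at hb
      intro a ha hm
      rw [← _root_.mul_assoc]
      exact h' _ (mul_mem ha (NonUnitalStarSubalgebra.le_topologicalClosure _ hb)) (h a ha hm)
    | smul c b hb h => exact 𝒢.isGood_smul c h
  intro a ha hm
  obtain ⟨u, hu, hlim⟩ := mem_closure_iff_seq_limit.1 hb
  refine (isMeagre_iUnion fun n => h1 (u n) (hu n) a ha hm).mono fun x hx => ?_
  by_contra hn
  simp only [mem_iUnion, not_exists, singSupport, mem_ofPred_eq, not_not] at hn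
  have hc : Continuous fun b : 𝒢.Families => 𝒢.rhoHom x (a * b) (delta (𝒢.unitAt x)) :=
    ((𝒢.continuous_rhoHom x).comp (continuous_const.mul continuous_id)).clm_apply continuous_const
  have := (hc.tendsto b).comp hlim
  refine hx (tendsto_nhds_unique this ?_)
  refine tendsto_const_nhds.congr fun n => (hn n).symm

end EtaleGroupoid

/-- A self-adjoint two-sided ideal in a complex `*`-algebra. -/
structure StarIdeal (A : Type*) [NonUnitalRing A] [StarRing A] [Module ℂ A] extends
    Submodule ℂ A where
  mul_mem_left : ∀ a b : A, b ∈ carrier → a * b ∈ carrier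
  mul_mem_right : ∀ a b : A, a ∈ carrier → a * b ∈ carrier
  star_mem : ∀ a : A, a ∈ carrier → star a ∈ carrier

namespace StarIdeal

variable {A : Type*} [NonUnitalRing A] [StarRing A] [Module ℂ A]

/-- The quotient `*`-algebra `A / J`. -/
def Quot (J : StarIdeal A) : Type _ := A ⧸ J.toSubmodule

variable (J : StarIdeal A)

instance : AddCommGroup J.Quot := inferInstanceAs (AddCommGroup (A ⧸ J.toSubmodule))

instance : Module ℂ J.Quot := inferInstanceAs (Module ℂ (A ⧸ J.toSubmodule))

/-- The quotient map, as a linear map. -/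
def mkₗ : A →ₗ[ℂ] J.Quot := J.toSubmodule.mkQ

theorem mkₗ_eq_iff (a b : A) : J.mkₗ a = J.mkₗ b ↔ a - b ∈ J.toSubmodule :=
  Submodule.Quotient.eq J.toSubmodule

theorem mkₗ_surjective : Function.Surjective J.mkₗ := J.toSubmodule.mkQ_surjective

instance : Mul J.Quot := ⟨Quotient.map₂ (· * ·) (by
  intro a a' h b b' h'
  have h1 := (J.mkₗ_eq_iff a a').1 (Quotient.sound h)
  have h2 := (J.mkₗ_eq_iff b b').1 (Quotient.sound h')
  refine Quotient.exact ((J.mkₗ_eq_iff _ _).2 ?_)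
  have : a * b - a' * b' = (a - a') * b + a' * (b - b') := by rw [sub_mul, mul_sub]; abel
  rw [this]
  exact J.add_mem (J.mul_mem_right _ _ h1) (J.mul_mem_left _ _ h2))⟩

instance : Star J.Quot := ⟨Quotient.map star (by
  intro a a' h
  have h1 := (J.mkₗ_eq_iff a a').1 (Quotient.sound h)
  refine Quotient.exact ((J.mkₗ_eq_iff _ _).2 ?_)
  rw [← star_sub]
  exact J.star_mem _ h1)⟩

theorem mkₗ_mul (a b : A) : J.mkₗ (a * b) = J.mkₗ a * J.mkₗ b := rfl

theorem mkₗ_star (a : A) : J.mkₗ (star a) = star (J.mkₗ a) := rfl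

instance : NonUnitalRing J.Quot where
  left_distrib x y z := by
    obtain ⟨a, rfl⟩ := J.mkₗ_surjective x
    obtain ⟨b, rfl⟩ := J.mkₗ_surjective y
    obtain ⟨c, rfl⟩ := J.mkₗ_surjective z
    simp only [← map_add, ← mkₗ_mul, mul_add]
  right_distrib x y z := by
    obtain ⟨a, rfl⟩ := J.mkₗ_surjective x
    obtain ⟨b, rfl⟩ := J.mkₗ_surjective y
    obtain ⟨c, rfl⟩ := J.mkₗ_surjective z
    simp only [← map_add, ← mkₗ_mul, add_mul]
  zero_mul x := by
    obtain ⟨a, rfl⟩ := J.mkₗ_surjective x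
    rw [← map_zero J.mkₗ, ← mkₗ_mul, zero_mul]
  mul_zero x := by
    obtain ⟨a, rfl⟩ := J.mkₗ_surjective x
    rw [← map_zero J.mkₗ, ← mkₗ_mul, mul_zero]
  mul_assoc x y z := by
    obtain ⟨a, rfl⟩ := J.mkₗ_surjective x
    obtain ⟨b, rfl⟩ := J.mkₗ_surjective y
    obtain ⟨c, rfl⟩ := J.mkₗ_surjective z
    simp only [← mkₗ_mul, mul_assoc]

instance : StarRing J.Quot where
  star_involutive x := by
    obtain ⟨a, rfl⟩ := J.mkₗ_surjective x
    rw [← mkₗ_star, ← mkₗ_star, star_star]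
  star_mul x y := by
    obtain ⟨a, rfl⟩ := J.mkₗ_surjective x
    obtain ⟨b, rfl⟩ := J.mkₗ_surjective y
    simp only [← mkₗ_mul, ← mkₗ_star, star_mul]
  star_add x y := by
    obtain ⟨a, rfl⟩ := J.mkₗ_surjective x
    obtain ⟨b, rfl⟩ := J.mkₗ_surjective y
    simp only [← map_add, ← mkₗ_star, star_add]

instance [IsScalarTower ℂ A A] : IsScalarTower ℂ J.Quot J.Quot where
  smul_assoc c x y := by
    obtain ⟨a, rfl⟩ := J.mkₗ_surjective x
    obtain ⟨b, rfl⟩ := J.mkₗ_surjective y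
    simp only [smul_eq_mul, ← map_smul, ← mkₗ_mul, smul_mul_assoc]

instance [SMulCommClass ℂ A A] : SMulCommClass ℂ J.Quot J.Quot where
  smul_comm c x y := by
    obtain ⟨a, rfl⟩ := J.mkₗ_surjective x
    obtain ⟨b, rfl⟩ := J.mkₗ_surjective y
    simp only [smul_eq_mul, ← map_smul, ← mkₗ_mul, mul_smul_comm]

instance [StarModule ℂ A] : StarModule ℂ J.Quot where
  star_smul c x := by
    obtain ⟨a, rfl⟩ := J.mkₗ_surjective x
    simp only [← map_smul, ← mkₗ_star, star_smul]

/-- The quotient `*`-homomorphism `A → A / J`. -/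
def quotHom : A →⋆ₙₐ[ℂ] J.Quot where
  toFun := J.mkₗ
  map_smul' := map_smul J.mkₗ
  map_zero' := map_zero J.mkₗ
  map_add' := map_add J.mkₗ
  map_mul' := J.mkₗ_mul
  map_star' := J.mkₗ_star

end StarIdeal

namespace EtaleGroupoid

variable {G X : Type*} [TopologicalSpace G] [TopologicalSpace X] (𝒢 : EtaleGroupoid G X)

/-- The ideal `J_sing` of `C*_r(𝒢)`: the elements `a` such that the set of `x ∈ 𝒢⁽⁰⁾` with
`ρ_x(a) δ_x ≠ 0` is meager. -/
def singularIdeal : StarIdeal 𝒢.reducedAlgebra where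
  carrier := {a | IsMeagre {x | 𝒢.rhoHom x a (delta (𝒢.unitAt x)) ≠ 0}}
  add_mem' {a b} ha hb := (IsMeagre.union ha hb).mono (𝒢.singSupport_add a b)
  zero_mem' := by
    have : IsMeagre (𝒢.singSupport 0) := by rw [singSupport_zero]; exact IsMeagre.empty
    exact this
  smul_mem' c a ha := IsMeagre.mono (𝒢.singSupport_smul c a) ha
  mul_mem_left a b hb := IsMeagre.mono (𝒢.singSupport_mul a b) hb
  mul_mem_right a b ha := 𝒢.isGood_of_mem b.2 a a.2 ha
  star_mem a ha := IsMeagre.mono (𝒢.singSupport_star a)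
    (𝒢.isGood_of_mem (star_mem a.2) a a.2 ha)

/-- The essential C*-algebra `C*_ess(𝒢) = C*_r(𝒢) / J_sing`, as a `*`-algebra (its C*-norm is
determined by the `*`-algebra structure). -/
abbrev EssentialAlgebra : Type _ := 𝒢.singularIdeal.Quot

/-- For a bijection `e : ι → 𝒢_x`, the representation `ρ_x` viewed as a representation on `ℓ²(ι)`
by means of the unitary `ℓ²(ι) → ℓ²(𝒢_x)`, `δ_i ↦ δ_{e i}`. -/
noncomputable def rhoOn {ι : Type*} {x : X} (e : ι ≃ 𝒢.Fiber x) :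
    𝒢.reducedAlgebra →⋆ₙₐ[ℂ] (Ell2 ι →L[ℂ] Ell2 ι) :=
  ((ell2Congr e).symm.conjStarAlgEquiv : _ →⋆ₙₐ[ℂ] _).comp
    ((𝒢.rhoHom x).comp (NonUnitalStarSubalgebraClass.subtype 𝒢.reducedAlgebra))

end EtaleGroupoid

namespace LCMonoid

variable {S : Type*} [LeftCancelMonoid S]

/-! ### The fibre over `χ_e` and the reduced C*-algebra of `S` -/

theorem InHull.map_mul {g : S ≃. S} (hg : InHull g) :
    ∀ {a b : S} (t : S), g a = some b → g (a * t) = some (b * t) := by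
  induction hg with
  | leftMul s =>
    intro a b t h
    have h' : s * a = b := Option.some.inj h
    subst h'
    exact congrArg some (mul_assoc s a t).symm
  | comp g h _ _ ihg ihh =>
    intro a b t H
    obtain ⟨c, h1, h2⟩ := (PEquiv.trans_eq_some _ _ _ _).1 H
    exact (PEquiv.trans_eq_some _ _ _ _).2 ⟨c * t, ihh t h1, ihg t h2⟩
  | symm g _ ih =>
    intro a b t H
    exact (PEquiv.eq_some_iff g).2 (ih t ((PEquiv.eq_some_iff g).1 H))

namespace GermSystem

variable (N : GermSystem S)

theorem dom_of (s : S) (χ : Omega S) : χ (Hull.of s).dom = true :=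
  χ.map_mono (fun t _ => ⟨s * t, rfl⟩) χ.map_dom_one

/-- The element `[s, χ_e]` of the fibre over `χ_e`. -/
noncomputable def germAt (s : S) : N.groupoid.Fiber (Omega.pt 1) :=
  ⟨germ (Hull.of s) (Omega.pt 1) (dom_of s _), rfl⟩

theorem germAt_bijective : Function.Bijective N.germAt := by
  constructor
  · intro s t h
    obtain ⟨A, hA, H⟩ := (germ_eq_germ _ _).1 (congrArg Subtype.val h)
    have h1 : (some (s * 1) : Option S) = some (t * 1) := H 1 (N.mem_of_pt 1 A hA)
    simpa using h1
  · rintro ⟨a, ha⟩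
    obtain ⟨g, χ, hg, rfl⟩ := exists_germ a
    obtain rfl : χ = Omega.pt 1 := ha
    obtain ⟨s, hs⟩ := (Omega.pt_apply 1 g.dom).1 hg
    refine ⟨s, Subtype.ext (germ_congr _ ?_ rfl)⟩
    refine Hull.ext' fun t => ?_
    have := InHull.map_mul g.2 t hs
    rw [_root_.one_mul] at this
    rw [this]; rfl

/-- The bijection `s ↦ [s, χ_e]` of `S` onto the fibre over `χ_e`. -/
noncomputable def fibreEquiv : S ≃ N.groupoid.Fiber (Omega.pt 1) :=
  Equiv.ofBijective N.germAt N.germAt_bijective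

/-- The representation `ρ_{χ_e}` of `C*_r` of the groupoid on `ℓ²(S)`, by means of the
identification of `S` with the fibre over `χ_e`, `s ↦ [s, χ_e]`. -/
noncomputable def rhoE : N.groupoid.reducedAlgebra →⋆ₙₐ[ℂ] (Ell2 S →L[ℂ] Ell2 S) :=
  N.groupoid.rhoOn N.fibreEquiv

end GermSystem

/-- The left regular representation, `λ_s δ_t = δ_{st}`. -/
noncomputable def leftReg (s : S) : Ell2 S →L[ℂ] Ell2 S :=
  (ell2Map (fun t => s * t) (mul_right_injective s)).toContinuousLinearMap

theorem leftReg_delta (s t : S) : leftReg s (delta t) = delta (s * t) :=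
  ell2Map_delta (fun t => s * t) (mul_right_injective s) t

variable (S) in
/-- The reduced C*-algebra `C*_r(S)`, generated by the operators `λ_s`, `s ∈ S`. -/
noncomputable def reducedAlgebra : NonUnitalStarSubalgebra ℂ (Ell2 S →L[ℂ] Ell2 S) :=
  (NonUnitalStarAlgebra.adjoin ℂ (range (leftReg (S := S)))).topologicalClosure

end LCMonoid

/-! ### Operators on `ℓ²` -/

/-! Nothing in the argument depends on which of the two germ relations is used, so everything is
proved for an arbitrary `GermSystem` `N`. Two facts are needed: the image of $\rho_{\chi_e}$ is
exactly $C^*_r(S)$, and its kernel is exactly $J_{\mathrm{sing}}$.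

Image. The characteristic functions `op g` of the compact bisections $D(g,\Omega(S))$ satisfy the
relations of $I_\ell(S)$ (`op_mul`, `star_op`), and their span is dense in $C^*_r(\mathcal G)$
(`reducedAlgebra_le`), because $\Omega(S)$ is totally disconnected and the functions
$\chi\mapsto\chi(p_X)$ span a dense subspace of $C(\Omega(S))$. Since $\rho_{\chi_e}$ sends the
element of a left translation to $\lambda_s$ (`rhoE_op_of`), the image lies in $C^*_r(S)$ and
contains its generators. The range of a $*$-homomorphism of C*-algebras is closed, so nothing is
missed.

Kernel inside $J_{\mathrm{sing}}$. Up to a unitary, $\rho_{\chi_e}(a)\delta_s$ is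
$\rho_{\chi_s}(a)\delta_{\chi_s}$, so $a$ is in the kernel if and only if
$\rho_\chi(a)\delta_\chi=0$ at all the points $\chi_s$, which are dense in $\Omega(S)$
(`rhoE_eq_zero_iff`). The coefficient of `op h` along a section $\chi\mapsto[g,\chi]$ is the
indicator of an open set, hence continuous off a nowhere dense frontier. As $I_\ell(S)$ is
countable, there is one meager set outside which all coefficients of all $a$ are continuous; there,
vanishing on a dense set forces vanishing (`isMeagre_singSupport`).

$J_{\mathrm{sing}}$ inside the kernel. The assumption on units says what is needed for the
coefficient along the unit section to be continuous at the single point $\chi_e$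
(`continuousAt_coef_one_op`). For $a\in J_{\mathrm{sing}}$ this coefficient vanishes on a comeager,
hence dense, set, so it vanishes at $\chi_e$: the $(e,e)$ matrix entry of $\rho_{\chi_e}(a)$ is
zero. Every other entry is the $(e,e)$ entry of an element $\lambda_t^*a\lambda_s$ of the same
ideal. -/

theorem Ell2.clm_ext {ι E : Type*} [AddCommGroup E] [TopologicalSpace E] [T2Space E] [Module ℂ E]
    {T T' : Ell2 ι →L[ℂ] E} (h : ∀ i, T (delta i) = T' (delta i)) : T = T' := by
  classical
  refine lp.ext_continuousLinearMap (by simp) fun i => ?_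
  ext
  have := h i
  unfold delta at this
  simp only [ContinuousLinearMap.comp_apply, lp.singleContinuousLinearMap_apply]
  convert this

theorem star_apply_eq {ι : Type*} (T : Ell2 ι →L[ℂ] Ell2 ι) (i j : ι) :
    (star T) (delta i) j = star (T (delta j) i) := by
  rw [← inner_delta, ContinuousLinearMap.star_eq_adjoint,
    ContinuousLinearMap.adjoint_inner_right, ← inner_conj_symm, inner_delta]
  rfl

/-! ### The range of a `*`-homomorphism of C*-algebras -/

section Range

variable {A B : Type*} [NonUnitalCStarAlgebra A] [NonUnitalCStarAlgebra B]

/-- Truncating $a$ by functional calculus at $\pm\|\varphi(a)\|$ does not change its image, because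
the truncation is the identity on the spectrum of $\varphi(a)$. -/
theorem NonUnitalStarAlgHom.exists_norm_le_of_isSelfAdjoint (φ : A →⋆ₙₐ[ℂ] B) {a : A}
    (ha : IsSelfAdjoint a) : ∃ a', φ a' = φ a ∧ ‖a'‖ ≤ ‖φ a‖ := by
  let f : ℝ → ℝ := fun t => max (-‖φ a‖) (min t ‖φ a‖)
  have hf : Continuous f := by fun_prop
  have hb : IsSelfAdjoint (φ a) := ha.map φ
  -- The non-unital functional calculus only accepts functions vanishing at 0.
  have hf0 : f 0 = 0 := by simp [f]
  have hφ : Continuous φ := AddMonoidHomClass.continuous_of_bound φ 1 fun a => by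
    rw [one_mul]; exact NonUnitalStarAlgHom.norm_apply_le φ a
  refine ⟨cfcₙ f a, ?_, norm_cfcₙ_le fun x _ => abs_le.2 ⟨le_max_left _ _, ?_⟩⟩
  · rw [NonUnitalStarAlgHom.map_cfcₙ (S := ℂ) φ f a hf.continuousOn hf0 hφ ha hb]
    conv_rhs => rw [← cfcₙ_id' ℝ (φ a)]
    refine cfcₙ_congr fun x hx => ?_
    have hx' : |x| ≤ ‖φ a‖ := by
      have := NonUnitalIsometricContinuousFunctionalCalculus.norm_quasispectrum_le (φ a) hx hb
      simpa using this
    have := abs_le.1 hx'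
    simp only [f]
    rw [min_eq_left this.2, max_eq_right this.1]
  · exact max_le ((neg_nonpos.2 (norm_nonneg _)).trans (norm_nonneg _)) (min_le_right _ _)

/-- Lift the real and imaginary parts separately. The factor 2 is not optimal, but any uniform
constant gives a closed range. -/
theorem NonUnitalStarAlgHom.exists_norm_le (φ : A →⋆ₙₐ[ℂ] B) (a : A) :
    ∃ a', φ a' = φ a ∧ ‖a'‖ ≤ 2 * ‖φ a‖ := by
  obtain ⟨x, hx, hx'⟩ := φ.exists_norm_le_of_isSelfAdjoint (realPart a).2
  obtain ⟨y, hy, hy'⟩ := φ.exists_norm_le_of_isSelfAdjoint (imaginaryPart a).2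
  have e1 : φ (realPart a : A) = realPart (φ a) := by
    rw [realPart_apply_coe, realPart_apply_coe, ← Complex.coe_smul, ← Complex.coe_smul, map_smul,
      map_add, map_star]
  have e2 : φ (imaginaryPart a : A) = imaginaryPart (φ a) := by
    simp only [imaginaryPart_apply_coe, map_smul]
    rw [← Complex.coe_smul, ← Complex.coe_smul, map_smul, map_sub, map_star]
  refine ⟨x + Complex.I • y, ?_, ?_⟩
  · rw [map_add, map_smul, hx, hy, ← map_smul, ← map_add, realPart_add_I_smul_imaginaryPart]
  · refine (norm_add_le _ _).trans ?_
    rw [norm_smul, Complex.norm_I, one_mul, two_mul]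
    refine add_le_add (hx'.trans ?_) (hy'.trans ?_)
    · rw [e1]; exact realPart.norm_le (φ a)
    · rw [e2]; exact imaginaryPart.norm_le (φ a)

/-- Norm-controlled lifts of the elements of the range can be summed along a rapidly converging
series, so by completeness of $A$ limits of the range lift as well. -/
theorem NonUnitalStarAlgHom.isClosed_range (φ : A →⋆ₙₐ[ℂ] B) : IsClosed (range φ) := by
  let f : NormedAddGroupHom A B :=
    { toFun := φ
      map_add' := map_add φ
      bound' := ⟨1, fun a => by rw [one_mul]; exact NonUnitalStarAlgHom.norm_apply_le φ a⟩ }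
  have h := controlled_closure_of_complete (f := f) (K := f.range) (C := 2) (ε := 1)
    two_pos one_pos (by
      rintro _ ⟨a, rfl⟩
      exact φ.exists_norm_le a)
  refine isClosed_of_closure_subset fun b hb => ?_
  obtain ⟨a, ha, -⟩ := h b hb
  exact ⟨a, ha⟩

end Range

/-! ### Quotients by self-adjoint ideals -/

/-- The first isomorphism theorem for bare $*$-algebras. No norm on the quotient is involved. -/
theorem StarIdeal.exists_equiv {A B : Type*} [NonUnitalRing A] [StarRing A] [Module ℂ A]
    [NonUnitalRing B] [StarRing B] [Module ℂ B] (J : StarIdeal A) (φ : A →⋆ₙₐ[ℂ] B)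
    (hker : ∀ a, φ a = 0 ↔ a ∈ J.toSubmodule) (hsurj : Function.Surjective φ) :
    ∃ Φ : J.Quot ≃⋆ₐ[ℂ] B, ∀ a, Φ (J.quotHom a) = φ a := by
  let ψ : J.Quot →ₗ[ℂ] B := J.toSubmodule.liftQ (φ : A →ₗ[ℂ] B) fun a ha => (hker a).2 ha
  have hψ : ∀ a, ψ (J.mkₗ a) = φ a := fun a => rfl
  let Ψ : J.Quot →⋆ₙₐ[ℂ] B :=
    { toFun := ψ
      map_smul' := map_smul ψ
      map_zero' := map_zero ψ
      map_add' := map_add ψ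
      map_mul' := fun x y => by
        obtain ⟨a, rfl⟩ := J.mkₗ_surjective x
        obtain ⟨b, rfl⟩ := J.mkₗ_surjective y
        rw [← J.mkₗ_mul, hψ, hψ, hψ, map_mul]
      map_star' := fun x => by
        obtain ⟨a, rfl⟩ := J.mkₗ_surjective x
        rw [← J.mkₗ_star, hψ, hψ, map_star] }
  have hΨ : ∀ a, Ψ (J.mkₗ a) = φ a := hψ
  refine ⟨StarAlgEquiv.ofBijective Ψ ⟨(injective_iff_map_eq_zero Ψ).2 fun x hx => ?_,
    fun b => ?_⟩, hψ⟩
  · obtain ⟨a, rfl⟩ := J.mkₗ_surjective x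
    rw [hΨ, hker] at hx
    rw [← map_zero J.mkₗ, J.mkₗ_eq_iff, sub_zero]
    exact hx
  · obtain ⟨a, rfl⟩ := hsurj b
    exact ⟨J.mkₗ a, hψ a⟩

namespace LCMonoid

variable {S : Type*} [LeftCancelMonoid S]

/-! ### Elements of the left inverse hull and of `Ω(S)` -/

/-- The composition of the left translations by the letters of a word and their inverses. -/
noncomputable def wordEval (l : List (S × Bool)) : S ≃. S :=
  l.foldr (fun p f => f.trans (cond p.2 (leftMul p.1) (leftMul p.1).symm)) (PEquiv.refl S)

theorem wordEval_cons (p : S × Bool) (l : List (S × Bool)) : wordEval (p :: l) =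
    (wordEval l).trans (cond p.2 (leftMul p.1) (leftMul p.1).symm) := rfl

theorem wordEval_append (l l' : List (S × Bool)) :
    wordEval (l ++ l') = (wordEval l').trans (wordEval l) := by
  induction l with
  | nil => exact (PEquiv.trans_refl _).symm
  | cons p l ih => rw [List.cons_append, wordEval_cons, ih, wordEval_cons, PEquiv.trans_assoc]

/-- Words are closed under concatenation and under reversing and inverting letters, so they exhaust
the hull. The purpose is countability. -/
theorem InHull.exists_word {g : S ≃. S} (hg : InHull g) : ∃ l, g = wordEval l := by
  induction hg with
  | leftMul s => exact ⟨[(s, true)], (PEquiv.refl_trans _).symm⟩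
  | comp g h _ _ ihg ihh =>
    obtain ⟨l, hl⟩ := ihg
    obtain ⟨l', hl'⟩ := ihh
    exact ⟨l ++ l', by rw [wordEval_append, ← hl, ← hl']⟩
  | symm g h ih =>
    obtain ⟨l, rfl⟩ := ih
    clear h
    induction l with
    | nil => exact ⟨[], rfl⟩
    | cons p l ih =>
      obtain ⟨l', hl'⟩ := ih
      refine ⟨l' ++ [(p.1, !p.2)], ?_⟩
      rw [wordEval_append, ← hl', wordEval_cons, PEquiv.symm_trans_rev, wordEval_cons]
      refine congrArg (fun f => PEquiv.trans f _) ?_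
      refine Eq.trans ?_ (PEquiv.refl_trans _).symm
      cases p.2 <;> rfl

/-- This is where countability of $S$ enters: exceptional sets indexed by pairs of elements of
$I_\ell(S)$ then have a meager union. -/
instance [Countable S] : Countable (Hull S) := by
  refine Set.Countable.to_subtype (s := {g : S ≃. S | InHull g}) ?_
  refine (countable_range (wordEval (S := S))).mono fun g hg => ?_
  obtain ⟨l, hl⟩ := InHull.exists_word hg
  exact ⟨l, hl.symm⟩

/-- Elements of $I_\ell(S)$ commute with right translations, so a value at the identity determines
the whole map. -/
theorem Hull.eq_of_of_apply_one {g : Hull S} {s : S} (h : g.1 1 = some s) : g = Hull.of s :=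
  Hull.ext' fun t => by
    have := InHull.map_mul g.2 t h
    rw [_root_.one_mul] at this
    rw [this]; rfl

theorem Hull.mul_of {g : Hull S} {s t : S} (h : g.1 s = some t) : g * Hull.of s = Hull.of t :=
  Hull.eq_of_of_apply_one (by
    rw [Hull.mul_apply]
    change g.1 (s * 1) = _
    rw [_root_.mul_one, h])

theorem CIdeal.mul_mem {X : CIdeal S} {s : S} (hs : s ∈ X) (t : S) : s * t ∈ X :=
  ((idOn_eq_some X.1 _ _).1
    (InHull.map_mul X.2 t ((idOn_eq_some X.1 s s).2 ⟨rfl, hs⟩))).2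

/-- The idempotent `p_X` as an element of `I_ℓ(S)`. -/
noncomputable def Hull.idem (X : CIdeal S) : Hull S := ⟨idOn X.1, X.2⟩

theorem Hull.idem_eq_some (X : CIdeal S) (a b : S) :
    (Hull.idem X).1 a = some b ↔ a = b ∧ a ∈ X := idOn_eq_some X.1 a b

theorem Hull.mul_idem_apply (g : Hull S) {X : CIdeal S} {t : S} (ht : t ∈ X) :
    (g * Hull.idem X).1 t = g.1 t := by
  rw [Hull.mul_apply, (Hull.idem_eq_some X t t).2 ⟨rfl, ht⟩]; rfl

theorem Hull.mem_dom_mul_idem (g : Hull S) (X : CIdeal S) (t : S) :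
    t ∈ (g * Hull.idem X).dom ↔ t ∈ g.dom ∧ t ∈ X := by
  rw [Hull.mem_dom, Hull.mem_dom]
  by_cases h : t ∈ X
  · simp [Hull.mul_idem_apply g h, h]
  · have : (Hull.idem X).1 t = none := by
      rw [Option.eq_none_iff_forall_not_mem]
      exact fun b hb => h ((Hull.idem_eq_some X t b).1 hb).2
    simp [Hull.mul_apply, this, h]

/-! ### Topology of $\Omega(S)$ and its locally constant functions. -/

instance : TotallyDisconnectedSpace (Omega S) :=
  inferInstanceAs (TotallyDisconnectedSpace {_χ : {_χ : CIdeal S → Bool // _} // _})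

theorem Omega.dense_range_pt : Dense (range (Omega.pt (S := S))) := by
  intro χ
  have hi : IsInducing (fun χ : Omega S => χ.1) := ⟨rfl⟩
  rw [hi.closure_eq_preimage_closure_image, mem_preimage, ← range_comp]
  exact χ.2

theorem Omega.dom_mul_idem (χ : Omega S) (g : Hull S) (X : CIdeal S) :
    χ (g * Hull.idem X).dom = true ↔ χ g.dom = true ∧ χ X = true := by
  rw [← χ.map_inf]
  have : (g * Hull.idem X).dom = g.dom ⊓ X := SetLike.ext fun t => Hull.mem_dom_mul_idem g X t
  rw [this]

/-- The characteristic function of `{χ | χ(p_X) = 1}`. -/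
noncomputable def Omega.char (X : CIdeal S) : C(Omega S, ℂ) :=
  ⟨{χ | χ X = true}.indicator 1, (Omega.isClopen_setOf X).continuous_indicator continuous_one⟩

theorem Omega.char_apply (X : CIdeal S) (χ : Omega S) :
    Omega.char X χ = if χ X = true then 1 else 0 := by
  classical exact Set.indicator_apply _ _ _

theorem Omega.char_inf (X Y : CIdeal S) : char (X ⊓ Y) = char X * char Y := by
  ext χ
  simp only [ContinuousMap.mul_apply, char_apply, map_inf]
  split_ifs <;> simp_all

theorem Omega.char_dom_one : char (1 : Hull S).dom = 1 := by
  ext χ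
  rw [char_apply, if_pos χ.map_dom_one]; rfl

theorem Omega.star_char (X : CIdeal S) : star (char X) = char X := by
  ext χ
  simp only [ContinuousMap.star_apply, char_apply]
  split_ifs <;> simp

/-- Stone–Weierstrass. The functions `char X` are real, contain 1 and are closed under products, so
their linear span is already the $*$-algebra they generate; distinct semi-characters differ on some
$X$, which gives separation of points. -/
theorem Omega.topologicalClosure_span_char :
    (Submodule.span ℂ (range (Omega.char (S := S)))).topologicalClosure = ⊤ := by
  have h1 : range (Omega.char (S := S)) ∪ star (range (Omega.char (S := S))) =
      range (Omega.char (S := S)) := by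
    refine union_eq_self_of_subset_right ?_
    rintro _ ⟨X, hX⟩
    exact ⟨X, by rw [← Omega.star_char, hX, star_star]⟩
  let M : Submonoid C(Omega S, ℂ) :=
    { carrier := range Omega.char
      one_mem' := ⟨_, Omega.char_dom_one⟩
      mul_mem' := by
        rintro _ _ ⟨X, rfl⟩ ⟨Y, rfl⟩
        exact ⟨X ⊓ Y, Omega.char_inf X Y⟩ }
  have h2 := StarAlgebra.adjoin_eq_span (R := ℂ) (range (Omega.char (S := S)))
  have h3 : Submonoid.closure (range (Omega.char (S := S))) = M := Submonoid.closure_eq M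
  rw [h1, h3] at h2
  have h4 := ContinuousMap.starSubalgebra_topologicalClosure_eq_top_of_separatesPoints
    (StarAlgebra.adjoin ℂ (range (Omega.char (S := S)))) (by
      intro χ ψ hne
      obtain ⟨X, hX⟩ : ∃ X, χ X ≠ ψ X := by
        by_contra! h
        exact hne (Omega.ext' h)
      refine ⟨_, ⟨Omega.char X, StarAlgebra.subset_adjoin _ _ ⟨X, rfl⟩, rfl⟩, ?_⟩
      change Omega.char X χ ≠ Omega.char X ψ
      rw [Omega.char_apply, Omega.char_apply]
      cases h : χ X <;> cases h' : ψ X <;> simp_all)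
  refine SetLike.coe_injective ?_
  have h5 : ((Submodule.span ℂ (range (Omega.char (S := S))) : Set C(Omega S, ℂ))) =
      (StarAlgebra.adjoin ℂ (range (Omega.char (S := S))) : Set C(Omega S, ℂ)) :=
    (congrArg (fun s : Submodule ℂ C(Omega S, ℂ) => (s : Set C(Omega S, ℂ))) h2).symm
  rw [Submodule.topologicalClosure_coe, h5, ← StarSubalgebra.topologicalClosure_coe, h4]
  rfl

/-- The set of characters having $A$ as a neighbourhood is open, and the $\chi_s$ are dense. An
equality of germs at $\chi$ can thus be tested at an actual element of $S$ with $\chi_s$ close to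
$\chi$. -/
theorem GermSystem.exists_mem_of_mem_nhd (N : GermSystem S) {χ : Omega S} {A : Set S}
    (hA : A ∈ N.nhd χ) {V : Set (Omega S)} (hV : IsOpen V) (hχ : χ ∈ V) :
    ∃ s ∈ A, Omega.pt s ∈ V := by
  obtain ⟨_, ⟨h1, h2⟩, s, rfl⟩ :=
    Omega.dense_range_pt.inter_open_nonempty _ ((N.isOpen A).inter hV) ⟨χ, hA, hχ⟩
  exact ⟨s, N.mem_of_pt s A h1, h2⟩

end LCMonoid

/-! ### Functions on one bisection and division in the fibres. -/

namespace EtaleGroupoid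

variable {G X : Type*} [TopologicalSpace G] [TopologicalSpace X] {𝒢 : EtaleGroupoid G X}

/-- For a function on a bisection, each row and column of the matrix of $\rho_x(f)$ has at most one
nonzero entry, so the supremum norm dominates the reduced norm. This makes `sectionOp` continuous.
-/
theorem norm_regRep_le {U : Set G} (hU : 𝒢.IsOpenBisection U) {f : 𝒢.Cc} (hf : f.1 ∈ CcOn U)
    {C : ℝ} (hC0 : 0 ≤ C) (hC : ∀ g, ‖f.1 g‖ ≤ C) : ‖𝒢.regRep f‖ ≤ C := by
  refine lp.norm_le_of_forall_le hC0 fun x => ?_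
  refine ContinuousLinearMap.opNorm_le_bound _ hC0 fun ξ => ?_
  refine lp.norm_le_of_forall_sum_le (by simp) (mul_nonneg hC0 (norm_nonneg _)) fun s => ?_
  refine le_trans (le_of_eq (Finset.sum_congr rfl fun g _ => ?_)) (sum_conv_le hU hf hC ξ s)
  exact congrArg (fun z : ℂ => ‖z‖ ^ (2 : ℝ≥0∞).toReal) (𝒢.rho_apply x f ξ g)

theorem mem_Cc {U : Set G} (hU : 𝒢.IsOpenBisection U) {f : G → ℂ} (hf : f ∈ CcOn U) : f ∈ 𝒢.Cc :=
  Submodule.subset_span (mem_biUnion hU hf)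

theorem divRight_val_eq_iff {x : X} (k m : 𝒢.Fiber x) (g : G) (H : 𝒢.src g = 𝒢.rng k.1) :
    (𝒢.divRight k m).1 = g ↔ 𝒢.mul g k.1 H = m.1 := by
  constructor
  · rintro rfl
    exact inv_mul_cancel_right (m.2.trans k.2.symm)
  · intro h
    exact (mul_congr h.symm rfl _).trans (mul_inv_cancel_right H)

end EtaleGroupoid

namespace LCMonoid

variable {S : Type*} [LeftCancelMonoid S]

namespace GermSystem

variable (N : GermSystem S)

/-! ### Functions on the bisections `D(g, Ω(S))` -/

theorem germ_mem_basicSet {g m : Hull S} {U : Set (Omega S)} {χ : Omega S} (hm : χ m.dom = true) :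
    (germ m χ hm : N.Germ) ∈ basicSet N g U ↔
      χ ∈ U ∧ ∃ hg : χ g.dom = true, (germ m χ hm : N.Germ) = germ g χ hg := by
  constructor
  · rintro ⟨ψ, hψ, hg, e⟩
    obtain rfl : χ = ψ := congrArg src e
    exact ⟨hψ, hg, e⟩
  · rintro ⟨hχ, hg, e⟩
    exact ⟨χ, hχ, hg, e⟩

/-- Injectivity of the range map: acting by $g^{-1}$ on the range of $[g,\chi]$ recovers $\chi$. -/
theorem isOpenBisection_basicSet (g : Hull S) {U : Set (Omega S)} (hU : IsOpen U) :
    N.groupoid.IsOpenBisection (basicSet N g U) := by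
  refine ⟨isOpen_basicSet g hU, ?_, ?_⟩
  · rintro _ ⟨χ, -, hχ, rfl⟩ _ ⟨ψ, -, hψ, rfl⟩ (e : χ = ψ)
    subst e; rfl
  · rintro _ ⟨χ, -, hχ, rfl⟩ _ ⟨ψ, -, hψ, rfl⟩ (e : Omega.act g χ hχ = Omega.act g ψ hψ)
    have h1 := Omega.act_inv_act g χ hχ
    have h2 := Omega.act_inv_act g ψ hψ
    simp only [e, h2] at h1
    subst h1; rfl

/-- The set is the image of a closed subset of the compact space $\Omega(S)$ under a continuous
section. It need not be closed among the germs, which may fail to be Hausdorff. -/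
theorem isCompact_basicSet (g : Hull S) : IsCompact (basicSet N g univ) := by
  have : CompactSpace {χ : Omega S // χ g.dom = true} :=
    isCompact_iff_compactSpace.1 (Omega.isClopen_setOf g.dom).isClosed.isCompact
  have h := isCompact_range (continuous_sect (N := N) g)
  convert h
  ext a
  constructor
  · rintro ⟨χ, -, hχ, rfl⟩; exact ⟨⟨χ, hχ⟩, rfl⟩
  · rintro ⟨χ, rfl⟩; exact ⟨χ.1, trivial, χ.2, rfl⟩

/-- The function on germs supported on `D(g, Ω(S))`, with value `φ(χ)` at `[g, χ]`. -/
noncomputable def bumpFun (g : Hull S) (φ : C(Omega S, ℂ)) : N.Germ → ℂ :=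
  (basicSet N g univ).indicator fun a => φ (src a)

theorem bumpFun_mem_CcOn (g : Hull S) (φ : C(Omega S, ℂ)) :
    N.bumpFun g φ ∈ EtaleGroupoid.CcOn (basicSet N g univ) := by
  refine ⟨?_, _, N.isCompact_basicSet g, subset_rfl, fun a ha => indicator_of_notMem ha _⟩
  exact (φ.continuous.comp continuous_src).continuousOn.congr fun a ha => indicator_of_mem ha _

/-- `bumpFun` as an element of `C_c` of the groupoid. -/
noncomputable def bump (g : Hull S) (φ : C(Omega S, ℂ)) : N.groupoid.Cc :=
  ⟨N.bumpFun g φ, EtaleGroupoid.mem_Cc (N.isOpenBisection_basicSet g isOpen_univ)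
    (N.bumpFun_mem_CcOn g φ)⟩

theorem bump_add (g : Hull S) (φ ψ : C(Omega S, ℂ)) :
    N.bump g (φ + ψ) = N.bump g φ + N.bump g ψ :=
  Subtype.ext (indicator_add _ (fun a => φ (src a)) fun a => ψ (src a))

theorem bump_smul (g : Hull S) (c : ℂ) (φ : C(Omega S, ℂ)) :
    N.bump g (c • φ) = c • N.bump g φ :=
  Subtype.ext (indicator_const_smul _ c fun a => φ (src a))

/-- The operator family given by `bump g φ`, as a bounded linear function of `φ`. -/
noncomputable def sectionOp (g : Hull S) : C(Omega S, ℂ) →L[ℂ] N.groupoid.Families :=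
  LinearMap.mkContinuous
    { toFun := fun φ => N.groupoid.regRep (N.bump g φ)
      map_add' := fun φ ψ => by rw [bump_add, EtaleGroupoid.regRep_add]
      map_smul' := fun c φ => by rw [bump_smul, EtaleGroupoid.regRep_smul]; rfl } 1 fun φ => by
    rw [_root_.one_mul]
    refine EtaleGroupoid.norm_regRep_le (N.isOpenBisection_basicSet g isOpen_univ)
      (N.bumpFun_mem_CcOn g φ) (norm_nonneg _) fun a => ?_
    exact (norm_indicator_le_norm_self (fun a => φ (src a)) a).trans (φ.norm_coe_le_norm _)

/-- The element of `C*_r` of the groupoid given by the characteristic function of `D(g, Ω(S))`. -/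
noncomputable def op (g : Hull S) : N.groupoid.Families := N.sectionOp g 1

/-- Cutting a function on $D(g,\Omega(S))$ down to $\{\chi(p_X)=1\}$ amounts to replacing $g$ by
$gp_X$, which has the same germs there. Density of the characters thereby becomes density of the
elements `op g`. -/
theorem sectionOp_char (g : Hull S) (X : CIdeal S) :
    N.sectionOp g (Omega.char X) = N.op (g * Hull.idem X) := by
  classical
  refine congrArg N.groupoid.regRep (Subtype.ext (funext fun a => ?_))
  change (basicSet N g univ).indicator (fun a => Omega.char X (src a)) a =
    (basicSet N (g * Hull.idem X) univ).indicator (fun _ => (1 : ℂ)) a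
  obtain ⟨m, χ, hm, rfl⟩ := exists_germ a
  have key : ∀ (h : χ g.dom = true) (h' : χ (g * Hull.idem X).dom = true),
      (germ g χ h : N.Germ) = germ (g * Hull.idem X) χ h' := fun h h' =>
    (germ_eq_germ _ _).2 ⟨_, N.of_mem χ X ((χ.dom_mul_idem g X).1 h').2, fun t ht =>
      (Hull.mul_idem_apply g ht).symm⟩
  simp only [indicator_apply, src_germ, Omega.char_apply, germ_mem_basicSet, mem_univ, true_and]
  by_cases h : χ (g * Hull.idem X).dom = true
  · have h' := (χ.dom_mul_idem g X).1 h
    simp only [h, h', exists_true_left, if_true, key h'.1 h]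
  · by_cases hX : χ X = true
    · have hg : ¬ χ g.dom = true := fun hg => h ((χ.dom_mul_idem g X).2 ⟨hg, hX⟩)
      simp [h, hg]
    · simp [h, hX]

/-! ### The elements `op g` as a representation of $I_\ell(S)$. -/

/-- The germ `[g, χ]` as an element of the fibre over `χ`. -/
def fib (g : Hull S) (χ : Omega S) (h : χ g.dom = true) : N.groupoid.Fiber χ := ⟨germ g χ h, rfl⟩

theorem exists_fib {χ : Omega S} (k : N.groupoid.Fiber χ) : ∃ g h, k = N.fib g χ h := by
  obtain ⟨k, hk⟩ := k
  obtain ⟨g, ψ, h, rfl⟩ := exists_germ k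
  obtain rfl : ψ = χ := hk
  exact ⟨g, h, rfl⟩

/-- On basis vectors, `[g, ·]` acts by multiplication on the left. -/
theorem op_delta (g h : Hull S) (χ : Omega S) (hh : χ h.dom = true)
    (hgh : χ (g * h).dom = true) :
    N.groupoid.rhoHom χ (N.op g) (delta (N.fib h χ hh)) = delta (N.fib (g * h) χ hgh) := by
  classical
  have hg : Omega.act h χ hh g.dom = true := by rw [Omega.mul_dom] at hgh; exact hgh
  ext m
  refine (N.groupoid.rho_apply _ _ _ _).trans ((EtaleGroupoid.conv_delta _ _ _).trans ?_)
  change (basicSet N g univ).indicator (fun _ => (1 : ℂ)) _ = _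
  have hiff := EtaleGroupoid.divRight_val_eq_iff (𝒢 := N.groupoid) (x := χ) (N.fib h χ hh) m
    (germ g _ hg) rfl
  have hmul : N.groupoid.mul (germ g _ hg) (N.fib h χ hh).1 rfl = germ (g * h) χ hgh :=
    mul_germ g h χ hh hg rfl
  rw [hmul] at hiff
  by_cases hm : m = (N.fib (g * h) χ hgh)
  · subst hm
    rw [delta_apply_self, hiff.2 rfl, indicator_of_mem]
    exact ⟨_, trivial, hg, rfl⟩
  · rw [delta_apply_ne hm, indicator_of_notMem]
    rintro ⟨ψ, -, hψ, e⟩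
    have hs : Omega.act h χ hh = ψ :=
      ((N.groupoid.divRight (N.fib h χ hh) m).2).symm.trans (congrArg src e)
    subst hs
    exact hm (Subtype.ext (hiff.1 e).symm)

theorem op_delta_eq_zero (g h : Hull S) (χ : Omega S) (hh : χ h.dom = true)
    (hgh : ¬ χ (g * h).dom = true) :
    N.groupoid.rhoHom χ (N.op g) (delta (N.fib h χ hh)) = 0 := by
  ext m
  refine (N.groupoid.rho_apply _ _ _ _).trans ((EtaleGroupoid.conv_delta _ _ _).trans ?_)
  change (basicSet N g univ).indicator (fun _ => (1 : ℂ)) _ = _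
  rw [indicator_of_notMem]
  · rfl
  rintro ⟨ψ, -, hψ, e⟩
  have hs : Omega.act h χ hh = ψ :=
    ((N.groupoid.divRight (N.fib h χ hh) m).2).symm.trans (congrArg src e)
  subst hs
  exact hgh (dom_mul hh hψ)

theorem families_ext_germ {a b : N.groupoid.Families}
    (H : ∀ (h : Hull S) (χ : Omega S) (hh : χ h.dom = true),
      N.groupoid.rhoHom χ a (delta (N.fib h χ hh)) =
        N.groupoid.rhoHom χ b (delta (N.fib h χ hh))) : a = b := by
  refine N.groupoid.families_ext fun χ => Ell2.clm_ext ?_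
  intro k
  obtain ⟨h, hh, rfl⟩ := N.exists_fib k
  exact H h χ hh

theorem dom_of_dom_mul {g h : Hull S} {χ : Omega S} (H : χ (g * h).dom = true) :
    χ h.dom = true :=
  χ.map_mono (fun t ht => by
    rw [Omega.mul_dom, Hull.mem_preim] at ht
    obtain ⟨r, -, hr⟩ := ht
    exact ⟨r, hr⟩) H

/-- Both sides send $\delta_{[k,\chi]}$ to $\delta_{[ghk,\chi]}$ when $ghk$ is defined at $\chi$,
and to 0 otherwise. -/
theorem op_mul (g h : Hull S) : N.op g * N.op h = N.op (g * h) := by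
  refine N.families_ext_germ fun k χ hk => ?_
  rw [map_mul, mul_apply_eq_comp]
  by_cases hhk : χ (h * k).dom = true
  · rw [N.op_delta h k χ hk hhk]
    by_cases H : χ (g * (h * k)).dom = true
    · have H' : χ (g * h * k).dom = true := by rw [Hull.mul_assoc']; exact H
      rw [N.op_delta g (h * k) χ hhk H, N.op_delta (g * h) k χ hk H']
      exact congrArg delta (Subtype.ext (germ_congr _ (Hull.mul_assoc' g h k).symm rfl))
    · rw [N.op_delta_eq_zero g _ χ hhk H, N.op_delta_eq_zero (g * h) k χ hk
        (by rw [Hull.mul_assoc']; exact H)]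
  · rw [N.op_delta_eq_zero h k χ hk hhk, map_zero, N.op_delta_eq_zero (g * h) k χ hk]
    rw [Hull.mul_assoc']
    exact fun H => hhk (dom_of_dom_mul H)

theorem op_delta_apply (g h m : Hull S) (χ : Omega S) (hh : χ h.dom = true)
    (hm : χ m.dom = true) :
    N.groupoid.rhoHom χ (N.op g) (delta (N.fib h χ hh)) (N.fib m χ hm) =
      open Classical in if ∃ hgh : χ (g * h).dom = true, (germ m χ hm : N.Germ) = germ _ χ hgh
        then 1 else 0 := by
  by_cases hgh : χ (g * h).dom = true
  · rw [N.op_delta g h χ hh hgh]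
    split_ifs with H
    · obtain ⟨_, H⟩ := H
      have : ((N.fib m χ hm) : N.groupoid.Fiber χ) = (N.fib _ χ hgh) := Subtype.ext H
      rw [this, delta_apply_self]
    · exact delta_apply_ne fun e => H ⟨hgh, congrArg Subtype.val e⟩
  · rw [N.op_delta_eq_zero g h χ hh hgh, if_neg fun H => hgh H.1]; rfl

/-- The relation $[m]=[g][h]$ can be solved for $[h]$. Used in both directions, it says that the 0–1
matrices of `op g` and `op g⁻¹` are transposes of each other, hence adjoint. -/
theorem germ_inv_mul_eq {g h m : Hull S} {χ : Omega S} (hh : χ h.dom = true) (hm : χ m.dom = true)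
    (H : ∃ hgh : χ (g * h).dom = true, (germ m χ hm : N.Germ) = germ _ χ hgh) :
    ∃ hgm : χ (g⁻¹ * m).dom = true, (germ h χ hh : N.Germ) = germ _ χ hgm := by
  obtain ⟨hgh, e⟩ := H
  obtain ⟨A, hA, HA⟩ := (germ_eq_germ _ _).1 e
  have hA' : ∀ t ∈ A ∩ {t | t ∈ (g * h).dom}, ∃ r, h.1 t = some r ∧ (g⁻¹ * m).1 t = some r := by
    rintro t ⟨ht, q, hq⟩
    have h1 := HA t ht
    have h2 := hq
    rw [Hull.mul_apply, Option.bind_eq_some_iff] at h2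
    obtain ⟨r, hr, hr'⟩ := h2
    refine ⟨r, hr, ?_⟩
    rw [Hull.mul_apply, h1, hq]
    exact (Hull.inv_eq_some g).2 hr'
  have hN := N.inter _ _ _ hA (N.of_mem χ _ hgh)
  have hd : χ (g⁻¹ * m).dom = true := by
    -- On this neighbourhood the domain of $g^{-1}m$ agrees with all of $S$, so $\chi$ takes the
    -- same value 1 on both.
    refine (N.separates χ _ (1 : Hull S).dom _ hN fun t ht => ⟨fun _ => ?_, fun _ => ?_⟩).1
      χ.map_dom_one
    · obtain ⟨r, -, hr⟩ := hA' t ht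
      exact ⟨r, hr⟩
    · simp [Hull.mem_dom, Hull.one_val]
  refine ⟨hd, (germ_eq_germ _ _).2 ⟨_, hN, fun t ht => ?_⟩⟩
  obtain ⟨r, h1, h2⟩ := hA' t ht
  rw [h1, h2]

theorem star_op (g : Hull S) : star (N.op g) = N.op g⁻¹ := by
  refine N.families_ext_germ fun h χ hh => ?_
  ext k
  obtain ⟨m, hm, rfl⟩ := N.exists_fib k
  rw [map_star, star_apply_eq, op_delta_apply, op_delta_apply]
  have : (∃ hgm : χ (g * m).dom = true, (germ h χ hh : N.Germ) = germ _ χ hgm) ↔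
      ∃ hgh : χ (g⁻¹ * h).dom = true, (germ m χ hm : N.Germ) = germ _ χ hgh :=
    ⟨N.germ_inv_mul_eq hm hh, N.germ_inv_mul_eq hh hm⟩
  split_ifs <;> simp_all

/-! ### Density of the span of the elements `op g` -/

/-- The linear span of the elements `op g`, `g ∈ I_ℓ(S)`. -/
noncomputable def opAlgebra : NonUnitalStarSubalgebra ℂ N.groupoid.Families where
  carrier := Submodule.span ℂ (range N.op)
  add_mem' := add_mem
  zero_mem' := zero_mem _
  smul_mem' c _ h := Submodule.smul_mem _ c h
  mul_mem' {a b} ha hb := by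
    simp only [SetLike.mem_coe] at ha hb ⊢
    induction ha using Submodule.span_induction with
    | mem a ha =>
      obtain ⟨g, rfl⟩ := ha
      induction hb using Submodule.span_induction with
      | mem b hb =>
        obtain ⟨h, rfl⟩ := hb
        rw [op_mul]
        exact Submodule.subset_span ⟨_, rfl⟩
      | zero => rw [mul_zero]; exact zero_mem _
      | add b c _ _ hb hc => rw [mul_add]; exact add_mem hb hc
      | smul c b _ hb => rw [mul_smul_comm]; exact Submodule.smul_mem _ _ hb
    | zero => rw [zero_mul]; exact zero_mem _
    | add a c _ _ ha hc => rw [add_mul]; exact add_mem ha hc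
    | smul c a _ ha => rw [smul_mul_assoc]; exact Submodule.smul_mem _ _ ha
  star_mem' {a} ha := by
    change a ∈ Submodule.span ℂ (range N.op) at ha
    change star a ∈ Submodule.span ℂ (range N.op)
    induction ha using Submodule.span_induction with
    | mem a ha =>
      obtain ⟨g, rfl⟩ := ha
      rw [star_op]
      exact Submodule.subset_span ⟨_, rfl⟩
    | zero => rw [star_zero]; exact zero_mem _
    | add a c _ _ ha hc => rw [star_add]; exact add_mem ha hc
    | smul c a _ ha => rw [star_smul]; exact Submodule.smul_mem _ _ ha

/-- Approximate $\varphi$ uniformly by combinations of characters and apply the bounded map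
`sectionOp g`. -/
theorem sectionOp_mem (g : Hull S) (φ : C(Omega S, ℂ)) :
    N.sectionOp g φ ∈ N.opAlgebra.topologicalClosure := by
  have hφ : φ ∈ (Submodule.span ℂ (range (Omega.char (S := S)))).topologicalClosure := by
    rw [Omega.topologicalClosure_span_char]; trivial
  refine map_mem_closure (t := (N.opAlgebra : Set N.groupoid.Families)) (N.sectionOp g).continuous
    hφ fun ψ hψ => ?_
  change N.sectionOp g ψ ∈ Submodule.span ℂ (range N.op)
  rw [SetLike.mem_coe] at hψ
  induction hψ using Submodule.span_induction with
  | mem ψ h =>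
    obtain ⟨X, rfl⟩ := h
    rw [sectionOp_char]
    exact Submodule.subset_span ⟨_, rfl⟩
  | zero => rw [map_zero]; exact zero_mem _
  | add ψ ψ' _ _ h h' => rw [map_add]; exact add_mem h h'
  | smul c ψ _ h => rw [map_smul]; exact Submodule.smul_mem _ _ h

/-- Since $V$ is clopen in the unit space, pulling $f$ back along the section and extending by zero
stays continuous. Extension by zero on the space of germs itself could fail to be continuous. -/
theorem exists_continuous_extension {g : Hull S} {V : Set (Omega S)} (hV : IsClopen V)
    (hVg : ∀ χ ∈ V, χ g.dom = true) {U : Set N.Germ} (hU : IsOpen U) (hVU : basicSet N g V ⊆ U)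
    {f : N.Germ → ℂ} (hf : ContinuousOn f U) : ∃ φ : C(Omega S, ℂ),
      (∀ χ (h : χ ∈ V), φ χ = f (germ g χ (hVg χ h))) ∧ ∀ χ ∉ V, φ χ = 0 := by
  classical
  let F : Omega S → ℂ := fun χ => if h : χ ∈ V then f (germ g χ (hVg χ h)) else 0
  have hF : Continuous F := by
    rw [continuous_iff_continuousAt]
    intro χ
    by_cases h : χ ∈ V
    · have hs : Continuous fun χ : V => (germ g χ.1 (hVg χ.1 χ.2) : N.Germ) :=
        (continuous_sect (N := N) g).comp
          (Continuous.subtype_mk (p := fun χ : Omega S => χ g.dom = true)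
            continuous_subtype_val fun χ : V => hVg χ.1 χ.2)
      rw [← hV.isOpen.isOpenEmbedding_subtypeVal.continuousAt_iff (x := ⟨χ, h⟩)]
      have e : F ∘ Subtype.val = fun χ : V => f (germ g χ.1 (hVg χ.1 χ.2)) := by
        ext χ; simp [F]
      rw [e]
      refine ContinuousAt.comp (f := fun χ : V => (germ g χ.1 (hVg χ.1 χ.2) : N.Germ)) (g := f)
        (hf.continuousAt (hU.mem_nhds (hVU ⟨χ, h, _, rfl⟩))) hs.continuousAt
    · refine continuousAt_const.congr (f := fun _ => (0 : ℂ)) ?_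
      filter_upwards [hV.compl.isOpen.mem_nhds h] with ψ hψ
      simp only [F, dif_neg (show ψ ∉ V from hψ)]
  exact ⟨⟨F, hF⟩, fun χ h => dif_pos h, fun χ h => dif_neg h⟩

/-- Induction on the cover. The part of $f$ over $V$ is a function on $D(g,\Omega(S))$, because the
bisection $U$ contains only the germ $[g,\chi]$ over $\chi\in V$; the rest of $f$ is covered by the
remaining sets. -/
theorem regRep_mem_of_cover {U : Set N.Germ} (hU : N.groupoid.IsOpenBisection U)
    (t : Finset (Hull S × Set (Omega S)))
    (ht : ∀ p ∈ t, IsClopen p.2 ∧ (∀ χ ∈ p.2, χ p.1.dom = true) ∧ basicSet N p.1 p.2 ⊆ U)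
    (f : N.groupoid.Cc) (hf : f.1 ∈ EtaleGroupoid.CcOn U)
    (hft : ∀ a, f.1 a ≠ 0 → ∃ p ∈ t, a ∈ basicSet N p.1 p.2) :
    N.groupoid.regRep f ∈ N.opAlgebra.topologicalClosure := by
  classical
  induction t using Finset.induction_on generalizing f with
  | empty =>
    have hf0 : f = 0 := Subtype.ext (funext fun a => by
      by_contra h
      obtain ⟨p, hp, -⟩ := hft a h
      simp at hp)
    have h0 := N.groupoid.regRep_smul 0 f
    rw [zero_smul, zero_smul, ← hf0] at h0
    rw [h0]
    exact zero_mem _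
  | insert p t _ ih =>
    obtain ⟨g, V⟩ := p
    obtain ⟨hV, hVg, hVU⟩ := ht _ (Finset.mem_insert_self _ _)
    dsimp only at hV hVg hVU
    obtain ⟨hfc, K, hK, hKU, hfK⟩ := hf
    have hfU : ∀ a, f.1 a ≠ 0 → a ∈ U := fun a ha => hKU (by_contra fun h => ha (hfK a h))
    obtain ⟨φ, hφ, hφ0⟩ := N.exists_continuous_extension hV hVg hU.1 hVU hfc
    let c : Omega S → ℂ := (Vᶜ).indicator fun _ => 1
    have hc : Continuous c := hV.compl.continuous_indicator continuous_const
    -- The cutoff depends only on the source and is continuous on $\Omega(S)$, so the remainder is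
    -- still continuous on $U$ and the same compact set $K$ serves as support.
    let f₂ : N.Germ → ℂ := fun a => f.1 a * c (src a)
    have hf₂ : f₂ ∈ EtaleGroupoid.CcOn U := by
      refine ⟨hfc.mul (hc.comp continuous_src).continuousOn, K, hK, hKU, fun a ha => ?_⟩
      simp only [f₂, hfK a ha, zero_mul]
    have hsum : f = N.bump g φ + ⟨f₂, EtaleGroupoid.mem_Cc hU hf₂⟩ := by
      refine Subtype.ext (funext fun a => ?_)
      change f.1 a = (basicSet N g univ).indicator (fun a => φ (src a)) a + f.1 a * c (src a)
      obtain ⟨m, χ, hm, rfl⟩ := exists_germ a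
      by_cases hχ : χ ∈ V
      · have hc0 : c χ = 0 := indicator_of_notMem (by simpa using hχ) _
        rw [src_germ, hc0, mul_zero, add_zero]
        have hgU : germ g χ (hVg χ hχ) ∈ U := hVU ⟨χ, hχ, _, rfl⟩
        by_cases hmem : (germ m χ hm : N.Germ) ∈ basicSet N g univ
        · rw [indicator_of_mem hmem, src_germ, hφ χ hχ]
          obtain ⟨-, hg, e⟩ := (N.germ_mem_basicSet hm).1 hmem
          rw [e]
        · rw [indicator_of_notMem hmem]
          by_contra hne
          -- A nonzero value would put this germ in $U$, where the source map is injective.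
          have e : (germ m χ hm : N.Germ) = germ g χ (hVg χ hχ) :=
            hU.2.1 (hfU _ hne) hgU rfl
          exact hmem (e ▸ ⟨χ, trivial, _, rfl⟩)
      · have hc1 : c χ = 1 := indicator_of_mem (show χ ∈ Vᶜ from hχ) _
        rw [src_germ, hc1, _root_.mul_one, right_eq_add]
        by_cases hmem : (germ m χ hm : N.Germ) ∈ basicSet N g univ
        · rw [indicator_of_mem hmem, src_germ, hφ0 χ hχ]
        · rw [indicator_of_notMem hmem]
    rw [hsum, EtaleGroupoid.regRep_add]
    refine add_mem (N.sectionOp_mem g φ)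
      (ih (fun p hp => ht p (Finset.mem_insert_of_mem hp)) ⟨f₂, _⟩ hf₂ fun a ha => ?_)
    have ha1 : f.1 a ≠ 0 := left_ne_zero_of_mul ha
    have ha2 : c (src a) ≠ 0 := right_ne_zero_of_mul ha
    obtain ⟨p, hp, hap⟩ := hft a ha1
    rcases Finset.mem_insert.1 hp with rfl | hp
    · obtain ⟨χ, hχ, hg, rfl⟩ := hap
      exact absurd (indicator_of_notMem (by simpa using hχ) _) ha2
    · exact ⟨p, hp, hap⟩

/-- The sets $D(g,V)\subseteq U$ with $V$ clopen cover the compact support of $f$, so finitely many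
of them suffice. -/
theorem regRep_mem_of_mem_CcOn {U : Set N.Germ} (hU : N.groupoid.IsOpenBisection U)
    (f : N.groupoid.Cc) (hf : f.1 ∈ EtaleGroupoid.CcOn U) :
    N.groupoid.regRep f ∈ N.opAlgebra.topologicalClosure := by
  classical
  obtain ⟨hfc, K, hK, hKU, hfK⟩ := id hf
  have hloc : ∀ a ∈ K, ∃ p : Hull S × Set (Omega S), (IsClopen p.2 ∧
      (∀ χ ∈ p.2, χ p.1.dom = true) ∧ basicSet N p.1 p.2 ⊆ U) ∧ a ∈ basicSet N p.1 p.2 := by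
    intro a ha
    obtain ⟨m, χ, hm, rfl⟩ := exists_germ a
    obtain ⟨V, hV, hχ, hVsub⟩ := compact_exists_isClopen_in_isOpen
      (isOpen_iff.1 hU.1 m) (show χ ∈ {χ | ∃ h, germ m χ h ∈ U} from ⟨hm, hKU ha⟩)
    refine ⟨(m, V), ⟨hV, fun ψ hψ => (hVsub hψ).1, ?_⟩, ⟨χ, hχ, hm, rfl⟩⟩
    rintro _ ⟨ψ, hψ, h, rfl⟩
    exact (hVsub hψ).2
  choose! p hp hmem using hloc
  obtain ⟨s, hsK⟩ := hK.elim_nhds_subcover' (fun a _ => basicSet N (p a).1 (p a).2)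
    fun a ha => (isOpen_basicSet _ (hp a ha).1.isOpen).mem_nhds (hmem a ha)
  refine N.regRep_mem_of_cover hU (s.image fun a => p a.1) ?_ f hf fun a ha => ?_
  · intro q hq
    obtain ⟨a, -, rfl⟩ := Finset.mem_image.1 hq
    exact hp a.1 a.2
  · have haK : a ∈ K := by_contra fun h => ha (hfK a h)
    obtain ⟨b, hb, hab⟩ := mem_iUnion₂.1 (hsK haK)
    exact ⟨_, Finset.mem_image_of_mem _ hb, hab⟩

/-- The closed span of the `op g` is already a $*$-algebra, so only the generators need checking,
and by linearity only those living on one bisection. -/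
theorem reducedAlgebra_le : N.groupoid.reducedAlgebra ≤ N.opAlgebra.topologicalClosure := by
  refine NonUnitalStarSubalgebra.topologicalClosure_minimal _ (NonUnitalStarAlgebra.adjoin_le ?_)
    (NonUnitalStarSubalgebra.isClosed_topologicalClosure _)
  rintro _ ⟨⟨f, hf⟩, rfl⟩
  induction hf using Submodule.span_induction with
  | mem f h =>
    have h' := h
    simp only [mem_iUnion, mem_ofPred_eq, exists_prop] at h'
    obtain ⟨U, hU, hf⟩ := h'
    exact N.regRep_mem_of_mem_CcOn hU _ hf
  | zero =>
    have : N.groupoid.regRep ⟨0, zero_mem _⟩ = 0 := by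
      have := N.groupoid.regRep_smul 0 0
      rwa [zero_smul, zero_smul] at this
    rw [this]
    exact zero_mem N.opAlgebra.topologicalClosure
  | add f f' hf hf' h h' =>
    have e := N.groupoid.regRep_add ⟨f, hf⟩ ⟨f', hf'⟩
    have e' : N.groupoid.regRep ⟨f + f', add_mem hf hf'⟩ = _ := e
    rw [e']
    exact add_mem (S := NonUnitalStarSubalgebra ℂ N.groupoid.Families) h h'
  | smul c f hf h =>
    have e := N.groupoid.regRep_smul c ⟨f, hf⟩
    have e' : N.groupoid.regRep ⟨c • f, Submodule.smul_mem _ c hf⟩ = _ := e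
    rw [e']
    exact SMulMemClass.smul_mem (S := NonUnitalStarSubalgebra ℂ N.groupoid.Families) c h

theorem op_mem (g : Hull S) : N.op g ∈ N.groupoid.reducedAlgebra :=
  NonUnitalStarSubalgebra.le_topologicalClosure _
    (NonUnitalStarAlgebra.subset_adjoin ℂ _ ⟨N.bump g 1, rfl⟩)

end GermSystem

end LCMonoid

namespace LCMonoid

variable {S : Type*} [LeftCancelMonoid S]

namespace GermSystem

variable (N : GermSystem S)

/-! ### Coefficients along the sections `χ ↦ [g, χ]` -/

/-- The coefficient of `ρ_χ(a) δ_χ` at `[g, χ]`, extended by zero to all `χ ∈ Ω(S)`. -/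
noncomputable def coef (g : Hull S) (χ : Omega S) : N.groupoid.Families →ₗ[ℂ] ℂ :=
  open Classical in if h : χ g.dom = true then
    { toFun := fun a => N.groupoid.rhoHom χ a (delta (N.groupoid.unitAt χ)) (N.fib g χ h)
      map_add' := fun _ _ => rfl
      map_smul' := fun _ _ => rfl }
  else 0

theorem coef_of_dom {g : Hull S} {χ : Omega S} (h : χ g.dom = true) (a : N.groupoid.Families) :
    N.coef g χ a = N.groupoid.rhoHom χ a (delta (N.groupoid.unitAt χ)) (N.fib g χ h) := by
  unfold coef; rw [dif_pos h]; rfl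

theorem norm_delta {ι : Type*} (i : ι) : ‖delta i‖ = 1 := (orthonormal_delta id fun _ _ h => h).1 i

theorem norm_rhoHom_le (χ : Omega S) (a : N.groupoid.Families) :
    ‖N.groupoid.rhoHom χ a‖ ≤ ‖a‖ := lp.norm_apply_le_norm (by simp) a χ

/-- The bound is uniform in $\chi$: norm approximation of $a$ gives uniform approximation of its
coefficient functions. -/
theorem norm_coef_le (g : Hull S) (χ : Omega S) (a : N.groupoid.Families) :
    ‖N.coef g χ a‖ ≤ ‖a‖ := by
  by_cases h : χ g.dom = true
  · rw [N.coef_of_dom h]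
    refine (lp.norm_apply_le_norm (by simp) _ _).trans ?_
    refine (ContinuousLinearMap.le_opNorm _ _).trans ?_
    rw [norm_delta, _root_.mul_one]
    exact N.norm_rhoHom_le χ a
  · unfold coef; rw [dif_neg h]; simp

theorem coef_op (g h : Hull S) (χ : Omega S) : N.coef g χ (N.op h) =
    {χ | ∃ (hg : χ g.dom = true) (hh : χ h.dom = true),
      (germ g χ hg : N.Germ) = germ h χ hh}.indicator (fun _ => (1 : ℂ)) χ := by
  classical
  by_cases hg : χ g.dom = true
  · rw [N.coef_of_dom hg]
    refine (N.groupoid.rho_apply _ _ _ _).trans ((EtaleGroupoid.conv_delta _ _ _).trans ?_)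
    rw [N.groupoid.divRight_unitAt]
    change (basicSet N h univ).indicator (fun _ => (1 : ℂ)) (germ g χ hg) = _
    simp only [indicator_apply, germ_mem_basicSet, mem_univ, true_and, mem_ofPred_eq, hg,
      exists_true_left]
  · unfold coef
    rw [dif_neg hg, indicator_of_notMem]
    · rfl
    · exact fun H => hg H.1

/-- Continuity at a point survives linear combinations and uniform limits, so it passes from the `op
h` to the closure of their span. -/
theorem continuousAt_coef {g : Hull S} {χ : Omega S}
    (H : ∀ h, ContinuousAt (fun ψ => N.coef g ψ (N.op h)) χ) {a : N.groupoid.Families}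
    (ha : a ∈ N.groupoid.reducedAlgebra) : ContinuousAt (fun ψ => N.coef g ψ a) χ := by
  have hspan : ∀ b ∈ Submodule.span ℂ (range N.op), ContinuousAt (fun ψ => N.coef g ψ b) χ := by
    intro b hb
    induction hb using Submodule.span_induction with
    | mem b hb => obtain ⟨h, rfl⟩ := hb; exact H h
    | zero => simp only [map_zero]; exact continuousAt_const
    | add b c _ _ hb hc => simp only [map_add]; exact hb.add hc
    | smul c b _ hb => simp only [map_smul]; exact hb.const_smul c
  refine continuousAt_of_locally_uniform_approx_of_continuousAt fun u hu => ?_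
  obtain ⟨ε, hε, hεu⟩ := Metric.mem_uniformity_dist.1 hu
  obtain ⟨b, hb, hab⟩ := Metric.mem_closure_iff.1 (N.reducedAlgebra_le ha) ε hε
  refine ⟨univ, Filter.univ_mem, _, hspan b hb, fun ψ _ => hεu ?_⟩
  rw [dist_eq_norm, ← map_sub]
  exact (N.norm_coef_le g ψ _).trans_lt (by rwa [← dist_eq_norm])

/-- This is the preimage of the open set $D(h,\Omega(S))$ under the section of $g$. It need not be
closed, and its frontier is the source of discontinuous coefficients. -/
theorem isOpen_setOf_germ_eq (g h : Hull S) :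
    IsOpen {χ : Omega S | ∃ (hg : χ g.dom = true) (hh : χ h.dom = true),
      (germ g χ hg : N.Germ) = germ h χ hh} := by
  have := isOpen_iff.1 (isOpen_basicSet (N := N) h isOpen_univ) g
  simpa only [germ_mem_basicSet, mem_univ, true_and] using this

/-- The indicator of an open set is continuous off its frontier, and the frontier of an open set is
closed with empty interior. -/
theorem isMeagre_not_continuousAt_coef_op (g h : Hull S) :
    IsMeagre {χ | ¬ ContinuousAt (fun ψ => N.coef g ψ (N.op h)) χ} := by
  have hO := N.isOpen_setOf_germ_eq g h
  simp only [coef_op]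
  set O := {χ : Omega S | ∃ (hg : χ g.dom = true) (hh : χ h.dom = true),
      (germ g χ hg : N.Germ) = germ h χ hh} with hOdef
  have hfr : IsNowhereDense (frontier O) := by
    rw [← frontier_compl, isClosed_frontier.isNowhereDense_iff, interior_frontier hO.isClosed_compl]
  refine hfr.isMeagre.mono fun χ hχ => ?_
  by_contra hn
  exact hχ (continuous_const.continuousOn.continuousAt_indicator hn)

/-- The kernel of `ρ_{χ_e}` consists of elements with meager singular support. -/
theorem isMeagre_singSupport [Countable S] {a : N.groupoid.Families} (ha : a ∈ N.groupoid.reducedAlgebra)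
    (h : ∀ s : S, N.groupoid.rhoHom (Omega.pt s) a
      (delta (N.groupoid.unitAt (Omega.pt s))) = 0) :
    IsMeagre (N.groupoid.singSupport a) := by
  refine (isMeagre_iUnion fun g : Hull S => isMeagre_iUnion fun h : Hull S =>
    N.isMeagre_not_continuousAt_coef_op g h).mono fun χ hχ => ?_
  by_contra hn
  simp only [mem_iUnion, mem_ofPred_eq, not_exists, not_not] at hn
  refine hχ (lp.ext (funext fun k => ?_))
  obtain ⟨g, hg, rfl⟩ := N.exists_fib k
  rw [← N.coef_of_dom hg]
  have hc := N.continuousAt_coef (hn g) ha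
  have h0 : ∀ s : S, N.coef g (Omega.pt s) a = 0 := by
    intro s
    by_cases hs : Omega.pt s g.dom = true
    · rw [N.coef_of_dom hs, h s]; rfl
    · unfold coef; rw [dif_neg hs]; rfl
  by_contra hne
  -- Continuity would keep the coefficient nonzero on a whole neighbourhood of $\chi$, which
  -- contains some $\chi_s$.
  obtain ⟨V, hV, hVo, hχV⟩ := mem_nhds_iff.1 (hc.eventually_ne hne)
  obtain ⟨_, hsV, s, rfl⟩ := Omega.dense_range_pt.inter_open_nonempty V hVo ⟨χ, hχV⟩
  exact hV hsV (h0 s)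

/-! ### Continuity of the coefficients at `χ_e` -/

/-- The only use of the structure of units. The coefficient is the indicator of the set $O$ of
$\chi$ with $[p_S,\chi]=[h,\chi]$, so $\chi_e$ must lie in $O$ or have a neighbourhood missing $O$.
If $h$ is defined at $e$ it is a left translation by some $s$, and the cases are $s=e$, $s$ a
nontrivial unit, and $s$ not invertible. -/
theorem continuousAt_coef_one_op
    (hS : ∀ u : Sˣ, u ≠ 1 → ∃ (m : ℕ) (X : Fin m → CIdeal S),
      (⋃ i, (X i : Set S)) ≠ univ ∧ ∀ s : S, s ∉ ⋃ i, (X i : Set S) → (u : S) * s ≠ s)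
    (h : Hull S) : ContinuousAt (fun ψ => N.coef 1 ψ (N.op h)) (Omega.pt (1 : S)) := by
  simp only [coef_op]
  set O := {χ : Omega S | ∃ (hg : χ (1 : Hull S).dom = true) (hh : χ h.dom = true),
      (germ 1 χ hg : N.Germ) = germ h χ hh} with hOdef
  suffices H : Omega.pt 1 ∈ O ∨ ∃ V : Set (Omega S), IsOpen V ∧ Omega.pt 1 ∈ V ∧ ∀ χ ∈ V, χ ∉ O by
    have hO : IsOpen O := N.isOpen_setOf_germ_eq 1 h
    rcases H with H | ⟨V, hV, h1, hVO⟩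
    · refine continuousAt_const.congr (f := fun _ => (1 : ℂ)) ?_
      filter_upwards [hO.mem_nhds H] with χ hχ
      rw [indicator_of_mem hχ]
    · refine continuousAt_const.congr (f := fun _ => (0 : ℂ)) ?_
      filter_upwards [hV.mem_nhds h1] with χ hχ
      rw [indicator_of_notMem (hVO χ hχ)]
  by_cases hh : Omega.pt (1 : S) h.dom = true
  swap
  · exact .inr ⟨_, (Omega.isClopen_setOf h.dom).compl.isOpen, hh, fun χ hχ H => hχ H.2.1⟩
  obtain ⟨s, hs⟩ := (Omega.pt_apply 1 h.dom).1 hh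
  obtain rfl := Hull.eq_of_of_apply_one hs
  by_cases hs1 : s = 1
  · subst hs1
    exact .inl ⟨Omega.map_dom_one _, hh, rfl⟩
  by_cases hsX : (1 : S) ∈ (Hull.of s)⁻¹.dom
  · obtain ⟨t, ht⟩ := hsX
    have hst : s * t = 1 := Option.some.inj ((Hull.inv_eq_some (Hull.of s)).1 ht)
    -- By left cancellation a right inverse is two-sided, so $e\in sS$ makes $s$ a unit.
    have hts : t * s = 1 := mul_left_cancel (a := s) (by
      rw [← _root_.mul_assoc, hst, _root_.one_mul, _root_.mul_one])
    obtain ⟨m, X, hX, hfix⟩ := hS ⟨s, t, hst, hts⟩ fun e => hs1 (congrArg Units.val e)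
    refine .inr ⟨⋂ i, {χ | χ (X i) = true}ᶜ,
      isOpen_iInter_of_finite fun i => (Omega.isClopen_setOf (X i)).compl.isOpen, ?_, ?_⟩
    -- The $X_i$ are right ideals: if $e\in X_i$ then $X_i=S$, contrary to the choice of the family.
    -- Hence $\chi_e(p_{X_i})=0$ for all $i$.
    · refine mem_iInter.2 fun i hi => hX (eq_univ_of_forall fun r => mem_iUnion.2 ⟨i, ?_⟩)
      have := CIdeal.mul_mem ((Omega.pt_apply 1 (X i)).1 hi) r
      rwa [_root_.one_mul] at this
    · rintro χ hχ ⟨h1, h2, e⟩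
      obtain ⟨A, hA, HA⟩ := (germ_eq_germ _ _).1 e
      -- Equality of germs at a character vanishing on all the $p_{X_i}$ would produce a fixed point
      -- $r$ of $s$ outside all the $X_i$.
      obtain ⟨r, hr, hrV⟩ := N.exists_mem_of_mem_nhd hA
        (isOpen_iInter_of_finite fun i => (Omega.isClopen_setOf (X i)).compl.isOpen) hχ
      refine hfix r (fun hrX => ?_) ?_
      · obtain ⟨i, hi⟩ := mem_iUnion.1 hrX
        exact mem_iInter.1 hrV i ((Omega.pt_apply r (X i)).2 hi)
      · have := HA r hr
        rw [Hull.one_val] at this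
        exact (Option.some.inj this).symm
  · refine .inr ⟨_, (Omega.isClopen_setOf (Hull.of s)⁻¹.dom).compl.isOpen,
      fun h1 => hsX ((Omega.pt_apply 1 _).1 h1), ?_⟩
    rintro χ hχ ⟨h1, h2, e⟩
    -- Equal germs have equal ranges, and every range of a germ of $s$ takes the value 1 on
    -- $p_{sS}$. Here $e\notin sS$, so $\chi_e$ takes the value 0.
    have hact : Omega.act 1 χ h1 = Omega.act (Hull.of s) χ h2 := congrArg rng e
    have := Omega.dom_inv_act (Hull.of s) χ h2
    rw [← hact, Omega.act_one] at this
    exact hχ this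

/-! ### The representation `ρ_{χ_e}` on `ℓ²(S)` -/

theorem rhoE_delta (a : N.groupoid.reducedAlgebra) (s t : S) : N.rhoE a (delta s) t =
    N.groupoid.rhoHom (Omega.pt 1) a (delta (N.fibreEquiv s)) (N.fibreEquiv t) := by
  have h : N.rhoE a (delta s) = (ell2Congr N.fibreEquiv).symm
      (N.groupoid.rhoHom (Omega.pt 1) a (ell2Congr N.fibreEquiv (delta s))) := rfl
  rw [h, ell2Congr_delta]
  rfl

theorem fibreEquiv_eq (s : S) : N.fibreEquiv s = N.fib (Hull.of s) (Omega.pt 1) (dom_of s _) := rfl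

/-- Under $s\mapsto[s,\chi_e]$, multiplying a germ on the left by $s$ is multiplication in $S$. -/
theorem rhoE_op_of (s : S) : N.rhoE ⟨N.op (Hull.of s), N.op_mem _⟩ = leftReg s := by
  refine Ell2.clm_ext fun t => ?_
  have hm : Hull.of s * Hull.of t = Hull.of (s * t) := Hull.mul_of rfl
  have hd : Omega.pt (1 : S) (Hull.of s * Hull.of t).dom = true := by rw [hm]; exact dom_of _ _
  have h1 : N.fib (Hull.of s * Hull.of t) _ hd = N.fibreEquiv (s * t) :=
    Subtype.ext (germ_congr _ hm rfl)
  ext r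
  rw [rhoE_delta, leftReg_delta, fibreEquiv_eq, N.op_delta _ _ _ _ hd, h1, ← ell2Congr_delta,
    ell2Congr_apply, Equiv.symm_apply_apply]

/-- Right multiplication by $[s,\chi_e]$ identifies the fibre over $\chi_s$ with the fibre over
$\chi_e$, takes the unit to $[s,\chi_e]$ and intertwines the representations (`rhoHom_delta`). -/
theorem rhoE_eq_zero_iff (a : N.groupoid.reducedAlgebra) : N.rhoE a = 0 ↔
    ∀ s : S, N.groupoid.rhoHom (Omega.pt s) a (delta (N.groupoid.unitAt (Omega.pt s))) = 0 := by
  have key : ∀ s : S, N.rhoE a (delta s) = 0 ↔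
      N.groupoid.rhoHom (Omega.pt s) a (delta (N.groupoid.unitAt (Omega.pt s))) = 0 := by
    intro s
    have h : N.rhoE a (delta s) = (ell2Congr N.fibreEquiv).symm
        (N.groupoid.rhoHom (Omega.pt 1) a (ell2Congr N.fibreEquiv (delta s))) := rfl
    have hs : N.groupoid.rng (N.fibreEquiv s).1 = Omega.pt s := by
      change Omega.act (Hull.of s) (Omega.pt 1) (dom_of s _) = _
      ext X
      rw [Bool.eq_iff_iff, Omega.act_apply, Omega.pt_apply, Omega.pt_apply, Hull.mem_preim]
      change (∃ r ∈ X, some (s * 1) = some r) ↔ _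
      simp
    rw [h, ell2Congr_delta, N.groupoid.rhoHom_delta a.2, LinearIsometryEquiv.map_eq_zero_iff,
      LinearIsometryEquiv.map_eq_zero_iff, hs]
  refine ⟨fun h s => (key s).1 (by rw [h]; rfl), fun h => Ell2.clm_ext fun s => ?_⟩
  rw [(key s).2 (h s)]; rfl

/-- The coefficient along the unit section is nonzero only on a meager set. If it were nonzero at
$\chi_e$, continuity there would make it nonzero on an open set. -/
theorem rhoE_delta_one_eq_zero
    (hS : ∀ u : Sˣ, u ≠ 1 → ∃ (m : ℕ) (X : Fin m → CIdeal S),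
      (⋃ i, (X i : Set S)) ≠ univ ∧ ∀ s : S, s ∉ ⋃ i, (X i : Set S) → (u : S) * s ≠ s)
    {a : N.groupoid.reducedAlgebra} (ha : a ∈ N.groupoid.singularIdeal.toSubmodule) :
    N.rhoE a (delta 1) 1 = 0 := by
  have hc := N.continuousAt_coef (N.continuousAt_coef_one_op hS) a.2
  have h1 : N.rhoE a (delta 1) 1 = N.coef 1 (Omega.pt 1) a := by
    rw [rhoE_delta, N.coef_of_dom (Omega.map_dom_one _)]; rfl
  rw [h1]
  by_contra hne
  obtain ⟨V, hV, hVo, hχV⟩ := mem_nhds_iff.1 (hc.eventually_ne hne)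
  have ha' : IsMeagre (N.groupoid.singSupport a.1) := ha
  -- Baire category in the compact Hausdorff space $\Omega(S)$.
  have hd : Dense (N.groupoid.singSupport a.1)ᶜ := dense_of_mem_residual ha'
  obtain ⟨χ, hχ, hχ'⟩ := hd.inter_open_nonempty V hVo ⟨_, hχV⟩
  refine hV hχ ?_
  have h0 : N.groupoid.rhoHom χ a.1 (delta (N.groupoid.unitAt χ)) = 0 := not_not.1 hχ'
  rw [N.coef_of_dom χ.map_dom_one, h0]; rfl

/-- The $(t,s)$ matrix entry is the $(e,e)$ entry of $\lambda_t^*\rho_{\chi_e}(a)\lambda_s$, which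
comes from another element of the two-sided ideal. -/
theorem rhoE_eq_zero_of_mem_singularIdeal
    (hS : ∀ u : Sˣ, u ≠ 1 → ∃ (m : ℕ) (X : Fin m → CIdeal S),
      (⋃ i, (X i : Set S)) ≠ univ ∧ ∀ s : S, s ∉ ⋃ i, (X i : Set S) → (u : S) * s ≠ s)
    {a : N.groupoid.reducedAlgebra} (ha : a ∈ N.groupoid.singularIdeal.toSubmodule) :
    N.rhoE a = 0 := by
  refine Ell2.clm_ext fun s => lp.ext (funext fun t => ?_)
  let e : S → N.groupoid.reducedAlgebra := fun s => ⟨N.op (Hull.of s), N.op_mem _⟩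
  have hb : star (e t) * (a * e s) ∈ N.groupoid.singularIdeal.toSubmodule :=
    N.groupoid.singularIdeal.mul_mem_left _ _ (N.groupoid.singularIdeal.mul_mem_right _ _ ha)
  have h := N.rhoE_delta_one_eq_zero hS hb
  have he : ∀ s, N.rhoE (e s) (delta 1) = delta s := fun s => by
    rw [N.rhoE_op_of, leftReg_delta, _root_.mul_one]
  rw [map_mul, map_mul, map_star, mul_apply_eq_comp, mul_apply_eq_comp, he, ← inner_delta,
    ContinuousLinearMap.star_eq_adjoint, ContinuousLinearMap.adjoint_inner_right, he,
    inner_delta] at h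
  exact h

theorem rhoE_eq_zero_iff_mem_singularIdeal [Countable S]
    (hS : ∀ u : Sˣ, u ≠ 1 → ∃ (m : ℕ) (X : Fin m → CIdeal S),
      (⋃ i, (X i : Set S)) ≠ univ ∧ ∀ s : S, s ∉ ⋃ i, (X i : Set S) → (u : S) * s ≠ s)
    (a : N.groupoid.reducedAlgebra) :
    N.rhoE a = 0 ↔ a ∈ N.groupoid.singularIdeal.toSubmodule :=
  ⟨fun h => N.isMeagre_singSupport a.2 ((N.rhoE_eq_zero_iff a).1 h),
    N.rhoE_eq_zero_of_mem_singularIdeal hS⟩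

/-! ### The image of $\rho_{\chi_e}$ and the isomorphism. -/

instance : IsClosed (N.groupoid.reducedAlgebra : Set N.groupoid.Families) :=
  NonUnitalStarSubalgebra.isClosed_topologicalClosure _

/-- Left translations go to the $\lambda_s$, and composition and inversion in the hull become
product and adjoint of operators. -/
theorem rhoE_op_mem (g : Hull S) : N.rhoE ⟨N.op g, N.op_mem g⟩ ∈ reducedAlgebra S := by
  obtain ⟨g, hg⟩ := g
  induction hg with
  | leftMul s =>
    have : N.rhoE ⟨N.op ⟨leftMul s, .leftMul s⟩, N.op_mem _⟩ = leftReg s := N.rhoE_op_of s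
    rw [this]
    exact NonUnitalStarSubalgebra.le_topologicalClosure _
      (NonUnitalStarAlgebra.subset_adjoin ℂ _ ⟨s, rfl⟩)
  | comp g h hg hh ihg ihh =>
    have e : (⟨N.op ⟨h.trans g, .comp _ _ hg hh⟩, N.op_mem _⟩ : N.groupoid.reducedAlgebra) =
        ⟨N.op ⟨g, hg⟩, N.op_mem _⟩ * ⟨N.op ⟨h, hh⟩, N.op_mem _⟩ :=
      Subtype.ext (N.op_mul ⟨g, hg⟩ ⟨h, hh⟩).symm
    rw [e, map_mul]
    exact mul_mem ihg ihh
  | symm g hg ih =>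
    have e : (⟨N.op ⟨g.symm, .symm _ hg⟩, N.op_mem _⟩ : N.groupoid.reducedAlgebra) =
        star ⟨N.op ⟨g, hg⟩, N.op_mem _⟩ := Subtype.ext (N.star_op ⟨g, hg⟩).symm
    rw [e, map_star]
    exact star_mem ih

/-- The representation `ρ_{χ_e}` on `ℓ²(S)`, on all bounded families. -/
noncomputable def rhoFamilies : N.groupoid.Families →⋆ₙₐ[ℂ] (Ell2 S →L[ℂ] Ell2 S) :=
  ((ell2Congr N.fibreEquiv).symm.conjStarAlgEquiv : _ →⋆ₙₐ[ℂ] _).comp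
    (N.groupoid.rhoHom (Omega.pt 1))

theorem rhoE_eq_rhoFamilies (a : N.groupoid.reducedAlgebra) : N.rhoE a = N.rhoFamilies a.1 := rfl

theorem continuous_rhoFamilies : Continuous N.rhoFamilies :=
  AddMonoidHomClass.continuous_of_bound N.rhoFamilies 1 fun a => by
    rw [_root_.one_mul]; exact NonUnitalStarAlgHom.norm_apply_le N.rhoFamilies a

/-- The approximants `op g` are available in the ambient algebra of families, so the limit is taken
there, through the extension `rhoFamilies`. -/
theorem rhoE_mem (a : N.groupoid.reducedAlgebra) : N.rhoE a ∈ reducedAlgebra S := by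
  have hcl : IsClosed (reducedAlgebra S : Set (Ell2 S →L[ℂ] Ell2 S)) :=
    NonUnitalStarSubalgebra.isClosed_topologicalClosure _
  have hspan : ∀ b ∈ Submodule.span ℂ (range N.op), N.rhoFamilies b ∈ reducedAlgebra S := by
    intro b hb
    induction hb using Submodule.span_induction with
    | mem b hb => obtain ⟨g, rfl⟩ := hb; exact N.rhoE_op_mem g
    | zero => rw [map_zero]; exact zero_mem _
    | add b c _ _ hb hc => rw [map_add]; exact add_mem hb hc
    | smul c b _ hb => rw [map_smul]; exact SMulMemClass.smul_mem c hb
  rw [rhoE_eq_rhoFamilies, ← SetLike.mem_coe, ← hcl.closure_eq]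
  exact map_mem_closure N.continuous_rhoFamilies (N.reducedAlgebra_le a.2) hspan

/-- The range is a $*$-algebra containing every $\lambda_s$, and it is closed because the domain is
a C*-algebra. -/
theorem reducedAlgebra_le_range : ∀ T ∈ reducedAlgebra S, ∃ a, N.rhoE a = T := by
  have hle : reducedAlgebra S ≤ NonUnitalStarAlgHom.range N.rhoE := by
    refine NonUnitalStarSubalgebra.topologicalClosure_minimal _
      (NonUnitalStarAlgebra.adjoin_le ?_) ?_
    · rintro _ ⟨s, rfl⟩
      exact ⟨_, N.rhoE_op_of s⟩
    · exact NonUnitalStarAlgHom.isClosed_range N.rhoE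
  exact fun T hT => hle hT

theorem exists_essentialAlgebra_equiv [Countable S]
    (hS : ∀ u : Sˣ, u ≠ 1 → ∃ (m : ℕ) (X : Fin m → CIdeal S),
      (⋃ i, (X i : Set S)) ≠ univ ∧ ∀ s : S, s ∉ ⋃ i, (X i : Set S) → (u : S) * s ≠ s) :
    ∃ Φ : N.groupoid.EssentialAlgebra ≃⋆ₐ[ℂ] reducedAlgebra S,
      ∀ a : N.groupoid.reducedAlgebra,
        (Φ (N.groupoid.singularIdeal.quotHom a) : Ell2 S →L[ℂ] Ell2 S) = N.rhoE a := by
  obtain ⟨Φ, hΦ⟩ := N.groupoid.singularIdeal.exists_equiv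
    (NonUnitalStarAlgHom.codRestrict N.rhoE (reducedAlgebra S) N.rhoE_mem)
    (fun a => by
      rw [← N.rhoE_eq_zero_iff_mem_singularIdeal hS]
      exact Subtype.ext_iff)
    fun ⟨T, hT⟩ => by
      obtain ⟨a, ha⟩ := N.reducedAlgebra_le_range T hT
      exact ⟨a, Subtype.ext ha⟩
  exact ⟨Φ, fun a => congrArg Subtype.val (hΦ a)⟩

end GermSystem

end LCMonoid

theorem proposition2p13 (S : Type*) [LeftCancelMonoid S] [Countable S]
    (hS : ∀ u : Sˣ, u ≠ 1 → ∃ (m : ℕ) (X : Fin m → LCMonoid.CIdeal S),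
      (⋃ i, (X i : Set S)) ≠ Set.univ ∧ ∀ s : S, s ∉ ⋃ i, (X i : Set S) → (u : S) * s ≠ s) :
    (∃ Φ : (LCMonoid.groupoidP S).EssentialAlgebra ≃⋆ₐ[ℂ] LCMonoid.reducedAlgebra S,
      ∀ a : (LCMonoid.groupoidP S).reducedAlgebra,
        (Φ ((LCMonoid.groupoidP S).singularIdeal.quotHom a) : Ell2 S →L[ℂ] Ell2 S) =
          (LCMonoid.idealSystem S).rhoE a) ∧
    (∃ Φ : (LCMonoid.groupoidQ S).EssentialAlgebra ≃⋆ₐ[ℂ] LCMonoid.reducedAlgebra S,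
      ∀ a : (LCMonoid.groupoidQ S).reducedAlgebra,
        (Φ ((LCMonoid.groupoidQ S).singularIdeal.quotHom a) : Ell2 S →L[ℂ] Ell2 S) =
          (LCMonoid.diffSystem S).rhoE a) :=
  -- Both groupoids are by definition the groupoids of their germ systems, so the general result
  -- applies to each.
  ⟨(LCMonoid.idealSystem S).exists_essentialAlgebra_equiv hS,
    (LCMonoid.diffSystem S).exists_essentialAlgebra_equiv hS⟩
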